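/- Let a Jacobi diagram (open Jacobi diagram) be a finite graph, possibly with loops and multiple edges, all of whose vertices have valence $1$ or $3$, together with a cyclic order of the three half-edges at each trivalent vertex. Diagrams are considered up to isomorphism preserving these cyclic orders. The degree of a diagram is half its total number of vertices, and its number of legs is its number of univalent vertices. A Jacobi diagram is called $n$-loop if it is (nonempty and) connected with Euler number $1-n$, i.e. with first Betti number $n$. Let $\mathcal{A}_{n\text{-loop}}$ be the $\mathbb{Q}$-vector space spanned by the $n$-loop Jacobi diagrams, subject to the following relations. * AS: $D'=-D$ whenever $D'$ is obtained from $D$ by reversing the cyclic order at one trivalent vertex. * IHX: $D_I=D_H-D_X$ whenever the three diagrams are identical except as follows: $D_I$ has an edge, with halves $e,e'$, joining two distinct trivalent vertices with cyclic orders $(e,a,b)$ and $(e',c,d)$, while $D_H$ has instead the vertices $(e,b,c)$ and $(e',d,a)$, and $D_X$ has instead the vertices $(e,a,c)$ and $(e',d,b)$. Let $\mathcal{A}_{n\text{-loop}}^{(\mathrm{odd})}\subseteq\mathcal{A}_{n\text{-loop}}$ be the subspace spanned by the diagrams of odd degree. **Theorem 3.1.** The space of $3$-loop Jacobi diagrams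 of odd degree vanishes: $\mathcal{A}_{3\text{-loop}}^{(\mathrm{odd})}=0$. Equivalently, every $3$-loop Jacobi diagram with an odd number of legs is zero in $\mathcal{A}_{3\text{-loop}}$. -/

import Mathlib

open Equiv

/-- A Jacobi diagram (open Jacobi diagram): a finite graph, loops and multiple edges allowed, all of
whose vertices have valence `1` or `3`, with a cyclic order of the three half-edges at each
trivalent vertex.

It is encoded by its finite set `H` of half-edges. The permutation `vert` sends a half-edge to the
next one, in the given cyclic order, at the same vertex; the vertices are the cycles of `vert`,
which have length `1` (univalent vertices) or `3` (oriented trivalent vertices). The fixed point free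
involution `edge` sends a half-edge to the other half of the same edge. -/
structure JacobiDiagram : Type 1 where
  /-- the half-edges -/
  H : Type
  finite_H : Finite H
  /-- the next half-edge at the same vertex -/
  vert : Perm H
  /-- the other half of the same edge -/
  edge : Perm H
  vert_vert_vert : ∀ h, vert (vert (vert h)) = h
  edge_edge : ∀ h, edge (edge h) = h
  edge_ne : ∀ h, edge h ≠ h

namespace JacobiDiagram

/-- The vertices of a diagram. -/
def Vertex (D : JacobiDiagram) : Type := Quotient (Perm.SameCycle.setoid D.vert)

/-- The edges of a diagram. -/
def Edge (D : JacobiDiagram) : Type := Quotient (Perm.SameCycle.setoid D.edge)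

/-- The degree: half the total number of vertices. -/
noncomputable def degree (D : JacobiDiagram) : ℚ := (Nat.card D.Vertex : ℚ) / 2

/-- The number of legs, counted by their univalent ends. (In a connected diagram with a trivalent
vertex, every edge adjacent to a univalent vertex has exactly one univalent end.) -/
noncomputable def numLegs (D : JacobiDiagram) : ℕ := Nat.card {h : D.H // D.vert h = h}

/-- The Euler number of the underlying graph. -/
noncomputable def eulerNumber (D : JacobiDiagram) : ℤ :=
  (Nat.card D.Vertex : ℤ) - (Nat.card D.Edge : ℤ)

/-- The underlying graph is nonempty and connected: any two half-edges are joined by a chain in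
which consecutive half-edges share a vertex or an edge. -/
def Connected (D : JacobiDiagram) : Prop :=
  Nonempty D.H ∧
    ∀ x y : D.H, Relation.EqvGen (fun u v => v = D.vert u ∨ v = D.edge u) x y

/-- An `n`-loop diagram: connected, with Euler number `1 - n`, i.e. first Betti number `n`. -/
def IsNLoop (n : ℕ) (D : JacobiDiagram) : Prop :=
  D.Connected ∧ D.eulerNumber = 1 - (n : ℤ)

/-- Isomorphism of Jacobi diagrams: graph isomorphism preserving the cyclic orders. -/
structure Iso (D D' : JacobiDiagram) where
  toEquiv : D.H ≃ D'.H
  map_vert : ∀ h, toEquiv (D.vert h) = D'.vert (toEquiv h)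
  map_edge : ∀ h, toEquiv (D.edge h) = D'.edge (toEquiv h)

/-- Rewiring: keep the edges and replace each half-edge `h` by `τ h` in the list of cyclically
ordered vertices, so that a vertex `(x, y, z)` becomes `(τ x, τ y, τ z)`. -/
def rewire (D : JacobiDiagram) (τ : Perm D.H) : JacobiDiagram where
  H := D.H
  finite_H := D.finite_H
  vert := τ * D.vert * τ⁻¹
  edge := D.edge
  vert_vert_vert h := by simp [D.vert_vert_vert]
  edge_edge := D.edge_edge
  edge_ne := D.edge_ne

open Classical in
/-- Reverse the cyclic order at the trivalent vertex containing `h`: with `(h, x, y)` the cyclic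
order at that vertex in `D`, the new cyclic order is `(x, h, y)`. -/
noncomputable def reverseAt (D : JacobiDiagram) (h : D.H) : JacobiDiagram :=
  D.rewire (swap h (D.vert h))

/-- `e` is half of an edge joining two distinct trivalent vertices. Such an edge with its two end
vertices is the "I" of an IHX relation. -/
def IsInternal (D : JacobiDiagram) (e : D.H) : Prop :=
  D.vert e ≠ e ∧ D.vert (D.edge e) ≠ D.edge e ∧ ¬ D.vert.SameCycle e (D.edge e)

open Classical in
/-- The "H" of the IHX relation. Let `e' = edge e` and let `(e, a, b)` and `(e', c, d)` be the
vertices in `D` (the "I": with `e` vertical and counterclockwise cyclic orders, `a`, `b`, `c`, `d`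
lead to the upper right, upper left, lower left and lower right). A quarter turn of the "I" gives
the "H", whose vertices are `(e, b, c)` and `(e', d, a)`. -/
noncomputable def ihxH (D : JacobiDiagram) (e : D.H) : JacobiDiagram :=
  let a := D.vert e
  let b := D.vert a
  let c := D.vert (D.edge e)
  let d := D.vert c
  D.rewire (swap a b * swap b c * swap c d)

open Classical in
/-- The "X" of the IHX relation: the "H" with its two upper ends `a` and `b` exchanged. In the
notation of `ihxH` its vertices are `(e, a, c)` and `(e', d, b)`. -/
noncomputable def ihxX (D : JacobiDiagram) (e : D.H) : JacobiDiagram :=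
  let a := D.vert e
  let b := D.vert a
  (D.ihxH e).rewire (swap (α := D.H) a b)

end JacobiDiagram

/-- The `n`-loop Jacobi diagrams. -/
abbrev NLoopDiagram (n : ℕ) : Type 1 := {D : JacobiDiagram // D.IsNLoop n}

open JacobiDiagram in
/-- The relators among `n`-loop Jacobi diagrams: isomorphic diagrams are identified, and the AS
relation and the IHX relation ("I" = "H" - "X") hold. -/
inductive JacobiRelator (n : ℕ) : (NLoopDiagram n →₀ ℚ) → Prop
  | iso (D D' : JacobiDiagram) (hD : D.IsNLoop n) (hD' : D'.IsNLoop n) (φ : Iso D D') :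
      JacobiRelator n (Finsupp.single ⟨D, hD⟩ 1 - Finsupp.single ⟨D', hD'⟩ 1)
  | antisymm (D : JacobiDiagram) (h : D.H) (hh : D.vert h ≠ h)
      (hD : D.IsNLoop n) (hR : (D.reverseAt h).IsNLoop n) :
      JacobiRelator n (Finsupp.single ⟨D, hD⟩ 1 + Finsupp.single ⟨D.reverseAt h, hR⟩ 1)
  | ihx (D : JacobiDiagram) (e : D.H) (he : D.IsInternal e)
      (hI : D.IsNLoop n) (hH : (D.ihxH e).IsNLoop n) (hX : (D.ihxX e).IsNLoop n) :
      JacobiRelator n (Finsupp.single ⟨D, hI⟩ 1 -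
        (Finsupp.single ⟨D.ihxH e, hH⟩ 1 - Finsupp.single ⟨D.ihxX e, hX⟩ 1))

/-- The space of `n`-loop Jacobi diagrams: the rational vector space spanned by `n`-loop Jacobi
diagrams subject to the AS and IHX relations. -/
abbrev NLoopSpace (n : ℕ) : Type 1 :=
  (NLoopDiagram n →₀ ℚ) ⧸ Submodule.span ℚ {r : NLoopDiagram n →₀ ℚ | JacobiRelator n r}

/-- The class of an `n`-loop Jacobi diagram in the space of `n`-loop Jacobi diagrams. -/
noncomputable def NLoopDiagram.toSpace {n : ℕ} (D : NLoopDiagram n) : NLoopSpace n :=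
  Submodule.Quotient.mk (Finsupp.single D 1)

/-- The odd degree part of the space of `n`-loop Jacobi diagrams: the subspace spanned by the
diagrams whose degree is an odd integer. -/
noncomputable def NLoopSpace.oddPart (n : ℕ) : Submodule ℚ (NLoopSpace n) :=
  Submodule.span ℚ
    {v | ∃ D : NLoopDiagram n, (∃ d : ℕ, Odd d ∧ D.1.degree = d) ∧ D.toSpace = v}

/-!
A diagram without edges joining two univalent vertices is determined by an involution `ε` of
`N × Fin 3`, where `N` is the set of trivalent vertices, `(i, 0)`, `(i, 1)`, `(i, 2)` are the
half-edges at `i` in their cyclic order, and the fixed points of `ε` carry the legs (`ofGluing`,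
`exists_iso_ofGluing`). Conjugating `ε` by a bijection which preserves the cyclic orders does not
change the diagram, reversing the order at one vertex changes the sign (`glueCls_flip`), and IHX
becomes `glueCls_ihx`. For three loops `card N` is the number of legs plus `4`, and the degree is
the number of legs plus `2`; so all claims say that `glueCls 3 ε = 0` when `card N` is odd
(`glueCls_eq_zero`).

IHX along an edge which leaves a path or a cycle expresses a diagram by two diagrams in which the
path or cycle passes through one more vertex (`glueCls_insert`). Starting from a single vertex one
arrives at a path through all trivalent vertices, which is then made part of a cycle by an edge that
joins two of its vertices, and the cycle is extended in the same way. Thus the diagrams with a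
Hamiltonian cycle, the wheels, span. A wheel of a three-loop diagram has two chords, and it is
determined by the cyclic word of its legs and chord ends (`wordCls`).

Let `card N` be odd. Reflecting a wheel reverses all cyclic orders and changes the sign
(`wordCls_reverse`), and a leg can be slid over the two ends of a chord (`wordCls_slide`).
If the chords are parallel, sliding moves legs freely between the two arcs which separate the chords,
and the reflection exchanging these arcs kills the wheel (`fourCls_parallel_eq_zero`). If they are
crossed, let `T k₁ k₂ k₃ k₄` be the wheel with these numbers of legs on its four arcs. It is
invariant under rotation, antisymmetric under reflection, and sliding gives a linear relation. If one
arc is empty, IHX at the edge which forms this arc relates `T 0 k₂ k₃ k₄`, a wheel with parallel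
chords, which vanishes, and a circle with a tripod inside. As the tripod may be rotated,
`T 0 k₂ k₃ k₄ = T 0 k₄ k₂ k₃` (`fourCls_tripod`). These relations imply that `T` depends only on the
total number of legs, and then antisymmetry gives `T = 0` (`eq_zero_of_crossed_relations`).
-/

namespace JacobiDiagram

/-! ### Diagrams and their classes -/

section

theorem sameCycle_vert_iff (D : JacobiDiagram) (x y : D.H) :
    D.vert.SameCycle x y ↔ y = x ∨ y = D.vert x ∨ y = D.vert (D.vert x) := by
  constructor
  · rintro ⟨i, rfl⟩
    have h3 : D.vert ^ (3 : ℤ) = 1 := by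
      ext h
      simpa [pow_succ] using D.vert_vert_vert h
    rw [zpow_eq_zpow_emod i h3]
    have h0 := Int.emod_nonneg i (b := 3) (by norm_num)
    have h1 := Int.emod_lt_of_pos i (b := 3) (by norm_num)
    generalize i % 3 = k at h0 h1
    interval_cases k
    · simp
    · simp
    · right; right
      exact congrArg (fun f : Perm D.H => f x) (pow_two D.vert)
  · rintro (rfl | rfl | rfl)
    · exact Perm.SameCycle.refl _ _
    · exact ⟨1, by simp⟩
    · exact ⟨2, congrArg (fun f : Perm D.H => f x) (pow_two D.vert)⟩

theorem sameCycle_edge_iff (D : JacobiDiagram) (x y : D.H) :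
    D.edge.SameCycle x y ↔ y = x ∨ y = D.edge x := by
  constructor
  · rintro ⟨i, rfl⟩
    have h2 : D.edge ^ (2 : ℤ) = 1 := by
      ext h
      simpa [pow_succ] using D.edge_edge h
    rw [zpow_eq_zpow_emod i h2]
    have h0 := Int.emod_nonneg i (b := 2) (by norm_num)
    have h1 := Int.emod_lt_of_pos i (b := 2) (by norm_num)
    generalize i % 2 = k at h0 h1
    interval_cases k
    · simp
    · simp
  · rintro (rfl | rfl)
    · exact Perm.SameCycle.refl _ _
    · exact ⟨1, by simp⟩

theorem two_mul_card_edge (D : JacobiDiagram) : 2 * Nat.card D.Edge = Nat.card D.H := by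
  classical
  have := D.finite_H
  have : Finite D.Edge := Quotient.finite _
  have := Fintype.ofFinite D.Edge
  let p : D.H → D.Edge := Quotient.mk _
  have hp : ∀ q : D.Edge, Nat.card {x // p x = q} = 2 := by
    intro q
    obtain ⟨x, rfl⟩ := Quotient.exists_rep q
    have hset : {y | p y = p x} = {x, D.edge x} := by
      ext y
      change p y = p x ↔ _
      rw [eq_comm, show p x = p y ↔ D.edge.SameCycle x y from Quotient.eq, sameCycle_edge_iff]
      rfl
    change Nat.card ({y | p y = p x} : Set D.H) = 2
    rw [hset, Nat.card_coe_set_eq, Set.ncard_pair (D.edge_ne x).symm]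
  rw [← Nat.card_congr (Equiv.sigmaFiberEquiv p), Nat.card_sigma]
  simp [hp, mul_comm]

namespace Iso

variable {D D' : JacobiDiagram}

/-- The inverse isomorphism. -/
def symm (φ : Iso D D') : Iso D' D where
  toEquiv := φ.toEquiv.symm
  map_vert h := by
    rw [Equiv.symm_apply_eq, φ.map_vert, Equiv.apply_symm_apply]
  map_edge h := by
    rw [Equiv.symm_apply_eq, φ.map_edge, Equiv.apply_symm_apply]

theorem card_vertex (φ : Iso D D') : Nat.card D.Vertex = Nat.card D'.Vertex := by
  refine Nat.card_congr (Quotient.congr φ.toEquiv fun x y => ?_)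
  change D.vert.SameCycle x y ↔ D'.vert.SameCycle _ _
  rw [sameCycle_vert_iff, sameCycle_vert_iff]
  simp only [← φ.map_vert, φ.toEquiv.apply_eq_iff_eq]

theorem card_edge (φ : Iso D D') : Nat.card D.Edge = Nat.card D'.Edge := by
  have h := Nat.card_congr φ.toEquiv
  have h1 := D.two_mul_card_edge
  have h2 := D'.two_mul_card_edge
  omega

theorem numLegs_eq (φ : Iso D D') : D.numLegs = D'.numLegs := by
  refine Nat.card_congr (φ.toEquiv.subtypeEquiv fun h => ?_)
  rw [← φ.map_vert, φ.toEquiv.apply_eq_iff_eq]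

theorem connected (φ : Iso D D') (h : D.Connected) : D'.Connected := by
  obtain ⟨⟨x⟩, hc⟩ := h
  refine ⟨⟨φ.toEquiv x⟩, fun y z => ?_⟩
  have key : ∀ u v, Relation.EqvGen (fun u v => v = D.vert u ∨ v = D.edge u) u v →
      Relation.EqvGen (fun u v => v = D'.vert u ∨ v = D'.edge u) (φ.toEquiv u) (φ.toEquiv v) := by
    intro u v huv
    induction huv with
    | rel u v h =>
      apply Relation.EqvGen.rel
      rcases h with rfl | rfl
      · exact Or.inl (φ.map_vert u)
      · exact Or.inr (φ.map_edge u)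
    | refl u => exact .refl _
    | symm u v _ ih => exact .symm _ _ ih
    | trans u v w _ _ ih1 ih2 => exact .trans _ _ _ ih1 ih2
  simpa using key _ _ (hc (φ.toEquiv.symm y) (φ.toEquiv.symm z))

theorem isNLoop {n : ℕ} (φ : Iso D D') (h : D.IsNLoop n) : D'.IsNLoop n :=
  ⟨φ.connected h.1, by
    rw [← h.2, eulerNumber, eulerNumber, φ.card_vertex, φ.card_edge]⟩

end Iso

open Classical in
/-- The class of a diagram in the space of `n`-loop diagrams; it is `0` by convention for a diagram
which is not `n`-loop. -/
noncomputable def cls (n : ℕ) (D : JacobiDiagram) : NLoopSpace n :=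
  if h : D.IsNLoop n then NLoopDiagram.toSpace ⟨D, h⟩ else 0

theorem cls_eq_toSpace {n : ℕ} (D : NLoopDiagram n) : cls n D.1 = D.toSpace :=
  dif_pos D.2

theorem mk_eq_zero_of_relator {n : ℕ} {r : NLoopDiagram n →₀ ℚ} (h : JacobiRelator n r) :
    (Submodule.Quotient.mk r : NLoopSpace n) = 0 :=
  (Submodule.Quotient.mk_eq_zero _).2 (Submodule.subset_span h)

theorem Iso.cls_eq {n : ℕ} {D D' : JacobiDiagram} (φ : Iso D D') : cls n D = cls n D' := by
  by_cases h : D.IsNLoop n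
  · have h' := φ.isNLoop h
    rw [cls, cls, dif_pos h, dif_pos h', ← sub_eq_zero]
    exact mk_eq_zero_of_relator (.iso D D' h h' φ)
  · have h' : ¬ D'.IsNLoop n := fun h' => h (φ.symm.isNLoop h')
    rw [cls, cls, dif_neg h, dif_neg h']

theorem cls_reverseAt {n : ℕ} (D : JacobiDiagram) (h : D.H) (hh : D.vert h ≠ h)
    (hR : (D.reverseAt h).IsNLoop n ↔ D.IsNLoop n) : cls n (D.reverseAt h) = - cls n D := by
  by_cases hD : D.IsNLoop n
  · rw [cls, cls, dif_pos hD, dif_pos (hR.2 hD), ← add_eq_zero_iff_eq_neg, add_comm]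
    exact mk_eq_zero_of_relator (.antisymm D h hh hD (hR.2 hD))
  · rw [cls, cls, dif_neg hD, dif_neg (mt hR.1 hD), neg_zero]

theorem cls_ihx {n : ℕ} (D : JacobiDiagram) (e : D.H) (he : D.IsInternal e)
    (hH : (D.ihxH e).IsNLoop n ↔ D.IsNLoop n) (hX : (D.ihxX e).IsNLoop n ↔ D.IsNLoop n) :
    cls n D = cls n (D.ihxH e) - cls n (D.ihxX e) := by
  by_cases hD : D.IsNLoop n
  · rw [cls, cls, cls, dif_pos hD, dif_pos (hH.2 hD), dif_pos (hX.2 hD), ← sub_eq_zero]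
    exact mk_eq_zero_of_relator (.ihx D e he hD (hH.2 hD) (hX.2 hD))
  · rw [cls, cls, cls, dif_neg hD, dif_neg (mt hH.1 hD), dif_neg (mt hX.1 hD), sub_zero]

end

/-! ### Gluing trivalent vertices along an involution -/

section

variable {N : Type} {ε ε₁ : N × Fin 3 → N × Fin 3}

/-- The next half-edge at a trivalent vertex, for trivalent vertices labelled by `N`. -/
def turn (N : Type) : Perm (N × Fin 3) := (Equiv.refl N).prodCongr (Equiv.addRight 1)

@[simp]
theorem turn_apply (i : N) (t : Fin 3) : turn N (i, t) = (i, t + 1) := rfl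

open Classical in
/-- The diagram with set of trivalent vertices `N`, where `(i, 0)`, `(i, 1)`, `(i, 2)` are the
half-edges at `i` in their cyclic order, glued along the involution `ε`. A fixed point of `ε` stands
for a leg: a univalent vertex is joined to it. -/
noncomputable def ofGluing [Finite N] (ε : N × Fin 3 → N × Fin 3) (hε : Function.Involutive ε) :
    JacobiDiagram where
  H := (N × Fin 3) ⊕ {x // ε x = x}
  finite_H := inferInstance
  vert := Perm.sumCongr (turn N) 1
  edge := Function.Involutive.toPerm
    (Sum.elim (fun x => if hx : ε x = x then Sum.inr ⟨x, hx⟩ else Sum.inl (ε x))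
      (fun x => Sum.inl x.1)) (by
        rintro (x | x)
        · by_cases hx : ε x = x
          · simp [hx]
          · have hx' : ε (ε x) ≠ ε x := by rw [hε x]; exact fun h => hx h.symm
            simp [hx, hε x]
            intro h; exact absurd h.symm hx
        · simp [x.2])
  vert_vert_vert := by
    rintro (⟨i, t⟩ | x)
    · simp [add_assoc]
    · simp
  edge_edge h := by
    exact Function.Involutive.toPerm_involutive _ h
  edge_ne := by
    rintro (x | x)
    · by_cases hx : ε x = x
      · exact fun h => Sum.inr_ne_inl ((dif_pos hx).symm.trans h)
      · exact fun h => hx (Sum.inl_injective ((dif_neg hx).symm.trans h))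
    · exact fun h => Sum.inl_ne_inr h

theorem involutive_of_conj (τ : Perm (N × Fin 3)) (hτ : ∀ x, τ (ε₁ x) = ε (τ x))
    (hε : Function.Involutive ε) : Function.Involutive ε₁ := fun x => τ.injective (by
  rw [hτ, hτ, hε])

theorem conj_symm (τ : Perm (N × Fin 3)) (hτ : ∀ x, τ (ε₁ x) = ε (τ x)) (x : N × Fin 3) :
    τ⁻¹ (ε x) = ε₁ (τ⁻¹ x) := by
  rw [Perm.inv_eq_iff_eq, hτ]; simp

theorem card_fixed_conj (τ : Perm (N × Fin 3)) (hτ : ∀ x, τ (ε₁ x) = ε (τ x)) :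
    Nat.card {x // ε₁ x = x} = Nat.card {x // ε x = x} :=
  Nat.card_congr (τ.subtypeEquiv fun x => by rw [← hτ, τ.apply_eq_iff_eq])

/-- Two trivalent vertices are adjacent. -/
def GlueAdj (ε : N × Fin 3 → N × Fin 3) (i j : N) : Prop := ∃ t u, ε (i, t) = (j, u)

/-- The trivalent vertices are connected to each other, and there are some. -/
def GlueConnected (ε : N × Fin 3 → N × Fin 3) : Prop :=
  Nonempty N ∧ ∀ i j, Relation.EqvGen (GlueAdj ε) i j

theorem GlueConnected.of_conj (τ : Perm (N × Fin 3)) (hτ : ∀ x, τ (ε₁ x) = ε (τ x))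
    (h : ∀ x, Relation.EqvGen (GlueAdj ε) (τ x).1 x.1) (hc : GlueConnected ε₁) :
    GlueConnected ε := by
  refine ⟨hc.1, fun i j => ?_⟩
  have h' := hc.2 i j
  induction h' with
  | rel i j hij =>
    obtain ⟨t, u, htu⟩ := hij
    have := hτ (i, t)
    rw [htu] at this
    refine .trans _ _ _ (.symm _ _ (h (i, t))) (.trans _ _ _ ?_ (h (j, u)))
    exact .rel _ _ ⟨(τ (i, t)).2, (τ (j, u)).2, this.symm⟩
  | refl u => exact .refl _
  | symm u v _ ih => exact .symm _ _ ih
  | trans u v w _ _ ih1 ih2 => exact .trans _ _ _ ih1 ih2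

variable [Finite N]

theorem ofGluing_vert_inr (hε : Function.Involutive ε) (x : {x // ε x = x}) :
    (ofGluing ε hε).vert (Sum.inr x) = Sum.inr x := rfl

theorem ofGluing_edge_inl_of_eq (hε : Function.Involutive ε) {x : N × Fin 3} (hx : ε x = x) :
    (ofGluing ε hε).edge (Sum.inl x) = Sum.inr ⟨x, hx⟩ := dif_pos hx

theorem ofGluing_edge_inl_of_ne (hε : Function.Involutive ε) {x : N × Fin 3} (hx : ε x ≠ x) :
    (ofGluing ε hε).edge (Sum.inl x) = Sum.inl (ε x) := dif_neg hx

theorem ofGluing_edge_inr (hε : Function.Involutive ε) (x : {x // ε x = x}) :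
    (ofGluing ε hε).edge (Sum.inr x) = Sum.inl x.1 := rfl

theorem connected_ofGluing_iff (hε : Function.Involutive ε) :
    (ofGluing ε hε).Connected ↔ GlueConnected ε := by
  constructor
  · rintro ⟨⟨x⟩, hc⟩
    refine ⟨⟨(Sum.elim id Subtype.val x : N × Fin 3).1⟩, fun i j => ?_⟩
    have key : ∀ u v, Relation.EqvGen
        (fun u v => v = (ofGluing ε hε).vert u ∨ v = (ofGluing ε hε).edge u) u v →
        Relation.EqvGen (GlueAdj ε) (Sum.elim id Subtype.val u : N × Fin 3).1
          (Sum.elim id Subtype.val v : N × Fin 3).1 := by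
      intro u v huv
      induction huv with
      | rel u v h =>
        rcases h with rfl | rfl
        · rcases u with u | u
          · exact .refl _
          · exact .refl _
        · rcases u with u | u
          · by_cases hu : ε u = u
            · rw [ofGluing_edge_inl_of_eq hε hu]
              exact .refl _
            · rw [ofGluing_edge_inl_of_ne hε hu]
              exact .rel _ _ ⟨u.2, (ε u).2, rfl⟩
          · exact .refl _
      | refl u => exact .refl _
      | symm u v _ ih => exact .symm _ _ ih
      | trans u v w _ _ ih1 ih2 => exact .trans _ _ _ ih1 ih2
    exact key (Sum.inl (i, 0)) (Sum.inl (j, 0)) (hc _ _)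
  · rintro ⟨⟨i⟩, hc⟩
    set R := Relation.EqvGen
        (fun u v => v = (ofGluing ε hε).vert u ∨ v = (ofGluing ε hε).edge u) with hR
    have h1 : ∀ i t, R (Sum.inl (i, t)) (Sum.inl (i, t + 1)) := fun i t => .rel _ _ (Or.inl rfl)
    have h2 : ∀ i t, R (Sum.inl (i, 0)) (Sum.inl (i, t)) := by
      intro i t
      have h01 := h1 i 0
      have h12 := h1 i 1
      fin_cases t
      · exact .refl _
      · exact h01
      · exact .trans _ _ _ h01 h12
    have h3 : ∀ x, R (Sum.inl x) (Sum.inl (ε x)) := by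
      intro x
      by_cases hx : ε x = x
      · rw [hx]; exact .refl _
      · exact .rel _ _ (Or.inr (ofGluing_edge_inl_of_ne hε hx).symm)
    have h4 : ∀ i j, Relation.EqvGen (GlueAdj ε) i j → R (Sum.inl (i, 0)) (Sum.inl (j, 0)) := by
      intro i j hij
      induction hij with
      | rel i j h =>
        obtain ⟨t, u, h⟩ := h
        refine .trans _ _ _ (h2 i t) (.trans _ _ _ (h3 _) ?_)
        rw [h]
        exact .symm _ _ (h2 j u)
      | refl u => exact .refl _
      | symm u v _ ih => exact .symm _ _ ih
      | trans u v w _ _ ih1 ih2 => exact .trans _ _ _ ih1 ih2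
    have h5 : ∀ x, R (Sum.inl (i, 0)) x := by
      rintro (⟨j, t⟩ | x)
      · exact .trans _ _ _ (h4 i j (hc i j)) (h2 j t)
      · refine .trans _ _ _ (.trans _ _ _ (h4 i x.1.1 (hc _ _)) (h2 _ x.1.2)) ?_
        exact .rel _ _ (Or.inr (ofGluing_edge_inl_of_eq hε x.2).symm)
    exact ⟨⟨Sum.inl (i, 0)⟩, fun x y => .trans _ _ _ (.symm _ _ (h5 x)) (h5 y)⟩

theorem card_vertex_ofGluing (hε : Function.Involutive ε) :
    Nat.card (ofGluing ε hε).Vertex = Nat.card N + Nat.card {x // ε x = x} := by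
  rw [← Nat.card_sum]
  have hs : ∀ x y : (ofGluing ε hε).H, (ofGluing ε hε).vert.SameCycle x y ↔
      (Sum.map Prod.fst id x : N ⊕ {x // ε x = x}) = Sum.map Prod.fst id y := by
    intro x y
    rw [sameCycle_vert_iff]
    rcases x with ⟨i, t⟩ | x <;> rcases y with ⟨j, u⟩ | y
    · constructor
      · rintro (h | h | h) <;> have h' := congrArg Prod.fst (Sum.inl_injective h) <;>
          exact congrArg Sum.inl h'.symm
      · intro h
        obtain rfl : i = j := Sum.inl_injective h
        have htu : u = t ∨ u = t + 1 ∨ u = t + 1 + 1 := by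
          clear h
          revert t u
          decide
        rcases htu with rfl | rfl | rfl
        · exact Or.inl rfl
        · exact Or.inr (Or.inl rfl)
        · exact Or.inr (Or.inr rfl)
    · refine ⟨?_, fun h => (Sum.inl_ne_inr h).elim⟩
      rintro (h | h | h) <;> exact (Sum.inr_ne_inl h).elim
    · refine ⟨?_, fun h => (Sum.inr_ne_inl h).elim⟩
      rintro (h | h | h) <;> exact (Sum.inl_ne_inr h).elim
    · refine ⟨?_, fun h => Or.inl (congrArg Sum.inr (Sum.inr_injective h).symm)⟩
      rintro (h | h | h) <;> exact congrArg Sum.inr (Sum.inr_injective h).symm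
  refine Nat.card_congr (Equiv.ofBijective (Quotient.lift (Sum.map Prod.fst id)
    fun x y h => (hs x y).1 h) ⟨?_, ?_⟩)
  · intro p q
    obtain ⟨x, rfl⟩ := Quotient.exists_rep p
    obtain ⟨y, rfl⟩ := Quotient.exists_rep q
    exact fun h => Quotient.sound ((hs x y).2 h)
  · rintro (i | x)
    · exact ⟨Quotient.mk _ (Sum.inl (i, 0)), rfl⟩
    · exact ⟨Quotient.mk _ (Sum.inr x), rfl⟩

theorem two_mul_card_edge_ofGluing (hε : Function.Involutive ε) :
    2 * Nat.card (ofGluing ε hε).Edge = 3 * Nat.card N + Nat.card {x // ε x = x} := by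
  rw [two_mul_card_edge]
  change Nat.card ((N × Fin 3) ⊕ {x // ε x = x}) = _
  rw [Nat.card_sum, Nat.card_prod, Nat.card_fin, mul_comm]

theorem isNLoop_ofGluing_iff {n : ℕ} (hε : Function.Involutive ε) :
    (ofGluing ε hε).IsNLoop n ↔
      GlueConnected ε ∧ Nat.card N + 2 = Nat.card {x // ε x = x} + 2 * n := by
  rw [IsNLoop, connected_ofGluing_iff, eulerNumber, card_vertex_ofGluing]
  have := two_mul_card_edge_ofGluing hε
  constructor <;> rintro ⟨h1, h2⟩ <;> exact ⟨h1, by omega⟩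

theorem numLegs_ofGluing (hε : Function.Involutive ε) :
    (ofGluing ε hε).numLegs = Nat.card {x // ε x = x} := by
  refine (Nat.card_congr (Equiv.ofBijective
    (fun x => ⟨Sum.inr x, ofGluing_vert_inr hε x⟩) ⟨?_, ?_⟩)).symm
  · intro x y h
    exact Sum.inr_injective (congrArg Subtype.val h)
  · rintro ⟨x | x, hx⟩
    · have h := congrArg Prod.snd (Sum.inl_injective hx)
      simp [turn] at h
    · exact ⟨x, rfl⟩

/-- Rewiring by a permutation which preserves the cyclic orders does not change the diagram. -/
def rewireIsoSelf (D : JacobiDiagram) (τ : Perm D.H) (h : ∀ x, τ (D.vert x) = D.vert (τ x)) :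
    Iso (D.rewire τ) D where
  toEquiv := Equiv.refl _
  map_vert x := by
    change τ (D.vert (τ⁻¹ x)) = D.vert x
    rw [h]; exact congrArg D.vert (τ.apply_symm_apply x)
  map_edge _ := rfl

/-- Conjugate involutions: gluing along `ε₁` amounts to rewiring the diagram glued along `ε`. -/
noncomputable def rewireIso (τ : Perm (N × Fin 3)) (hτ : ∀ x, τ (ε₁ x) = ε (τ x))
    (hε : Function.Involutive ε) (hε₁ : Function.Involutive ε₁) :
    Iso (ofGluing ε₁ hε₁) ((ofGluing ε hε).rewire (Perm.sumCongr τ 1)) where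
  toEquiv := Equiv.sumCongr τ (τ.subtypeEquiv fun x => by rw [← hτ, τ.apply_eq_iff_eq])
  map_vert := by
    rintro (x | x)
    · change Sum.inl (τ (turn N x)) = Sum.inl (τ (turn N (τ⁻¹ (τ x))))
      simp
    · rfl
  map_edge := by
    rintro (x | x)
    · by_cases hx : ε₁ x = x
      · have hx' : ε (τ x) = τ x := by rw [← hτ, hx]
        rw [ofGluing_edge_inl_of_eq _ hx]
        exact (ofGluing_edge_inl_of_eq hε hx').symm
      · have hx' : ε (τ x) ≠ τ x := by rw [← hτ]; exact fun h => hx (τ.injective h)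
        rw [ofGluing_edge_inl_of_ne _ hx]
        refine Eq.trans ?_ (ofGluing_edge_inl_of_ne hε hx').symm
        exact congrArg Sum.inl (hτ x)
    · rfl

theorem isNLoop_ofGluing_conj {n : ℕ} (τ : Perm (N × Fin 3)) (hτ : ∀ x, τ (ε₁ x) = ε (τ x))
    (hε : Function.Involutive ε) (hε₁ : Function.Involutive ε₁)
    (h : ∀ x, Relation.EqvGen (GlueAdj ε) (τ x).1 x.1)
    (h₁ : ∀ x, Relation.EqvGen (GlueAdj ε₁) (τ⁻¹ x).1 x.1) :
    (ofGluing ε₁ hε₁).IsNLoop n ↔ (ofGluing ε hε).IsNLoop n := by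
  rw [isNLoop_ofGluing_iff, isNLoop_ofGluing_iff, card_fixed_conj τ hτ]
  have : GlueConnected ε₁ ↔ GlueConnected ε :=
    ⟨GlueConnected.of_conj τ hτ h, GlueConnected.of_conj τ⁻¹ (conj_symm τ hτ) h₁⟩
  rw [this]

open Classical in
/-- The class of the diagram glued along `ε`, with the value `0` if `ε` is not an involution. -/
noncomputable def glueCls (n : ℕ) (ε : N × Fin 3 → N × Fin 3) : NLoopSpace n :=
  if h : Function.Involutive ε then cls n (ofGluing ε h) else 0

variable {n : ℕ}

theorem glueCls_eq (hε : Function.Involutive ε) : glueCls n ε = cls n (ofGluing ε hε) := dif_pos hε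

theorem glueCls_of_not_involutive (hε : ¬ Function.Involutive ε) : glueCls n ε = 0 := dif_neg hε

/-- The class vanishes by convention unless the diagram is connected with the right number of legs,
so these properties may be assumed in order to prove that it vanishes. -/
theorem glueCls_eq_zero_of (h : Function.Involutive ε → GlueConnected ε →
    Nat.card N + 2 = Nat.card {x // ε x = x} + 2 * n → glueCls n ε = 0) : glueCls n ε = 0 := by
  by_cases hε : Function.Involutive ε
  · by_cases hn : (ofGluing ε hε).IsNLoop n
    · have := (isNLoop_ofGluing_iff hε).1 hn
      exact h hε this.1 this.2
    · rw [glueCls_eq hε, cls, dif_neg hn]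
  · exact glueCls_of_not_involutive hε

theorem glueCls_smul_of_conj (τ : Perm (N × Fin 3))
    (hτ : ∀ x, τ (ε₁ x) = ε (τ x)) (c : ℚ)
    (h : ∀ hε : Function.Involutive ε, ∀ hε₁ : Function.Involutive ε₁,
      cls n (ofGluing ε₁ hε₁) = c • cls n (ofGluing ε hε)) : glueCls n ε₁ = c • glueCls n ε := by
  by_cases hε : Function.Involutive ε
  · have hε₁ := involutive_of_conj τ hτ hε
    rw [glueCls_eq hε, glueCls_eq hε₁, h]
  · have hε₁ : ¬ Function.Involutive ε₁ :=
      fun h₁ => hε (involutive_of_conj τ⁻¹ (conj_symm τ hτ) h₁)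
    rw [glueCls_of_not_involutive hε, glueCls_of_not_involutive hε₁, smul_zero]

/-- A bijection of the half-edges which preserves the cyclic orders is an isomorphism. -/
theorem glueCls_conj (τ : Perm (N × Fin 3)) (hv : ∀ x, τ (turn N x) = turn N (τ x))
    (hτ : ∀ x, τ (ε₁ x) = ε (τ x)) : glueCls n ε₁ = glueCls n ε := by
  have := glueCls_smul_of_conj (n := n) τ hτ 1 (fun hε hε₁ => by
    rw [one_smul, (rewireIso τ hτ hε hε₁).cls_eq]
    refine (rewireIsoSelf _ _ ?_).cls_eq
    rintro (x | x)
    · exact congrArg Sum.inl (hv x)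
    · rfl)
  rwa [one_smul] at this

theorem swap_instance_irrel {α : Type*} (i₁ i₂ : DecidableEq α) (a b : α) :
    @swap α i₁ a b = @swap α i₂ a b := by
  congr!

variable [DecidableEq N]

/-- The AS relation. -/
theorem glueCls_flip (i : N) (t : Fin 3)
    (hτ : ∀ x, swap (i, t) (i, t + 1) (ε₁ x) = ε (swap (i, t) (i, t + 1) x)) :
    glueCls n ε₁ = - glueCls n ε := by
  rw [← neg_one_smul ℚ]
  refine glueCls_smul_of_conj (n := n) _ hτ (-1) fun hε hε₁ => ?_
  have hfst : ∀ x : N × Fin 3, (swap (i, t) (i, t + 1) x).1 = x.1 := by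
    intro x
    rw [swap_apply_def]
    split_ifs with h h <;> simp [h]
  have hiso := rewireIso _ hτ hε hε₁
  have heq : (ofGluing ε hε).rewire (Perm.sumCongr (swap (i, t) (i, t + 1)) 1) =
      (ofGluing ε hε).reverseAt (Sum.inl (i, t)) := by
    rw [Perm.sumCongr_swap_one]
    exact congrArg (ofGluing ε hε).rewire (swap_instance_irrel _ _ _ _)
  rw [heq] at hiso
  rw [neg_one_smul, hiso.cls_eq]
  apply cls_reverseAt
  · intro h
    have h := congrArg Prod.snd (Sum.inl_injective h)
    simp [turn] at h
  · rw [← isNLoop_ofGluing_conj _ hτ hε hε₁]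
    · exact ⟨hiso.symm.isNLoop, hiso.isNLoop⟩
    · intro x; rw [hfst]; exact .refl _
    · intro x; rw [swap_inv, hfst]; exact .refl _

end

/-! ### The IHX relation for glued diagrams -/

section

variable {N : Type} {ε ε₁ ε₂ : N × Fin 3 → N × Fin 3} {n : ℕ}

/-- Renaming the vertices. -/
theorem glueCls_relabel [Finite N] (π : Perm N)
    (hτ : ∀ x, Prod.map π id (ε₁ x) = ε (Prod.map π id x)) : glueCls n ε₁ = glueCls n ε :=
  glueCls_conj (π.prodCongr (Equiv.refl _)) (fun _ => rfl) hτ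

/-- Conjugation of a gluing map by a permutation of the half-edges. -/
def conj (τ : Perm (N × Fin 3)) (ε : N × Fin 3 → N × Fin 3) : N × Fin 3 → N × Fin 3 :=
  fun x => τ⁻¹ (ε (τ x))

theorem apply_conj (τ : Perm (N × Fin 3)) (ε : N × Fin 3 → N × Fin 3) (x : N × Fin 3) :
    τ (conj τ ε x) = ε (τ x) := τ.apply_symm_apply _

theorem eq_conj {τ : Perm (N × Fin 3)} (h : ∀ x, τ (ε₁ x) = ε (τ x)) : ε₁ = conj τ ε :=
  funext fun x => τ.injective ((h x).trans (apply_conj τ ε x).symm)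

theorem conj_mul (τ τ' : Perm (N × Fin 3)) (ε : N × Fin 3 → N × Fin 3) :
    conj (τ * τ') ε = conj τ' (conj τ ε) :=
  funext fun x => by simp [conj]

theorem eqvGen_of_ends {i j : N} (h : ε (i, 2) = (j, 2)) {τ : Perm (N × Fin 3)}
    (hτ : ∀ y t, τ (y, t) = (y, t) ∨ ((y = i ∨ y = j) ∧ ((τ (y, t)).1 = i ∨ (τ (y, t)).1 = j)))
    (x : N × Fin 3) : Relation.EqvGen (GlueAdj ε) (τ x).1 x.1 := by
  have hij : Relation.EqvGen (GlueAdj ε) i j := .rel _ _ ⟨2, 2, h⟩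
  obtain ⟨y, t⟩ := x
  rcases hτ y t with h1 | ⟨rfl | rfl, h1 | h1⟩
  · rw [h1]; exact .refl _
  · rw [h1]; exact .refl _
  · rw [h1]; exact .symm _ _ hij
  · rw [h1]; exact hij
  · rw [h1]; exact .refl _

theorem isNLoop_ofGluing_conj_of_ends [Finite N] {i j : N} {τ : Perm (N × Fin 3)}
    (hτ : ∀ x, τ (ε₁ x) = ε (τ x)) (hε : Function.Involutive ε) (hε₁ : Function.Involutive ε₁)
    (h : ε (i, 2) = (j, 2)) (hi : τ (i, 2) = (i, 2)) (hj : τ (j, 2) = (j, 2))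
    (h₁ : ∀ y t, τ (y, t) = (y, t) ∨ ((y = i ∨ y = j) ∧ ((τ (y, t)).1 = i ∨ (τ (y, t)).1 = j))) :
    (ofGluing ε₁ hε₁).IsNLoop n ↔ (ofGluing ε hε).IsNLoop n := by
  have h' : ε₁ (i, 2) = (j, 2) := τ.injective (by rw [hτ, hi, hj, h])
  refine isNLoop_ofGluing_conj τ hτ hε hε₁ (eqvGen_of_ends h h₁) fun x => ?_
  have := eqvGen_of_ends h' h₁ (τ⁻¹ x)
  rw [show τ (τ⁻¹ x) = x from τ.apply_symm_apply x] at this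
  exact .symm _ _ this

variable [DecidableEq N]

/-- The rewiring which turns the "I" with stem `(i, 2)`, `(j, 2)` into the "H". -/
def ihxPerm (i j : N) : Perm (N × Fin 3) :=
  swap (i, 0) (i, 1) * swap (i, 1) (j, 0) * swap (j, 0) (j, 1)

theorem ihxPerm_apply {i j : N} (hij : i ≠ j) (y : N) (t : Fin 3) :
    ihxPerm i j (y, t) = if y = i then ![(i, 1), (j, 0), (i, 2)] t
      else if y = j then ![(j, 1), (i, 0), (j, 2)] t else (y, t) := by
  by_cases hi : y = i
  · subst hi
    fin_cases t <;> simp [ihxPerm, swap_apply_def, hij, hij.symm]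
  · by_cases hj : y = j
    · subst hj
      fin_cases t <;> simp [ihxPerm, swap_apply_def, hij.symm]
    · simp [ihxPerm, swap_apply_def, hi, hj]

theorem rewire_rewire (D : JacobiDiagram) (p q : Perm D.H) :
    (D.rewire q).rewire p = D.rewire (p * q) := by
  simp only [rewire]
  congr 1

open Classical in
theorem ihxH_eq (D : JacobiDiagram) (e e' : D.H) (h : D.edge e = e') :
    D.ihxH e = D.rewire (swap (D.vert e) (D.vert (D.vert e)) *
      swap (D.vert (D.vert e)) (D.vert e') * swap (D.vert e') (D.vert (D.vert e'))) := by
  subst h; rfl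

open Classical in
theorem ihxX_eq (D : JacobiDiagram) (e e' : D.H) (h : D.edge e = e') :
    D.ihxX e = (D.rewire (swap (D.vert e) (D.vert (D.vert e)) *
      swap (D.vert (D.vert e)) (D.vert e') * swap (D.vert e') (D.vert (D.vert e')))).rewire
        (swap (α := D.H) (D.vert e) (D.vert (D.vert e))) := by
  subst h; rfl

/-- The IHX relation. -/
theorem glueCls_ihx [Finite N] {i j : N} (hij : i ≠ j) (h : ε (i, 2) = (j, 2))
    (h₁ : ∀ x, ihxPerm i j (ε₁ x) = ε (ihxPerm i j x))
    (h₂ : ∀ x, (swap (i, 0) (i, 1) * ihxPerm i j : Perm (N × Fin 3)) (ε₂ x) =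
      ε ((swap (i, 0) (i, 1) * ihxPerm i j : Perm (N × Fin 3)) x)) :
    glueCls n ε = glueCls n ε₁ - glueCls n ε₂ := by
  by_cases hε : Function.Involutive ε
  swap
  · rw [glueCls_of_not_involutive hε, glueCls_of_not_involutive, glueCls_of_not_involutive,
      sub_zero]
    · exact fun h' => hε (involutive_of_conj _ (conj_symm _ h₂) h')
    · exact fun h' => hε (involutive_of_conj _ (conj_symm _ h₁) h')
  have hε₁ := involutive_of_conj _ h₁ hε
  have hε₂ := involutive_of_conj _ h₂ hε
  rw [glueCls_eq hε, glueCls_eq hε₁, glueCls_eq hε₂]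
  have iso₁ := rewireIso _ h₁ hε hε₁
  have iso₂ := rewireIso _ h₂ hε hε₂
  have hne : ε (i, 2) ≠ (i, 2) := by rw [h]; simp [hij.symm]
  have hedge : (ofGluing ε hε).edge (Sum.inl (i, 2)) = Sum.inl (j, 2) := by
    rw [ofGluing_edge_inl_of_ne hε hne, h]
  have hm : ∀ p q : Perm (N × Fin 3), Perm.sumCongr (p * q) (1 : Perm {x // ε x = x}) =
      Perm.sumCongr p 1 * Perm.sumCongr q 1 := fun p q => by simp [Perm.sumCongr_mul]
  have e₁ : (ofGluing ε hε).rewire (Perm.sumCongr (ihxPerm i j) 1) =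
      (ofGluing ε hε).ihxH (Sum.inl (i, 2)) := by
    rw [ihxH_eq _ _ _ hedge]
    refine congrArg (ofGluing ε hε).rewire ?_
    rw [ihxPerm]
    rw [hm, hm, Perm.sumCongr_swap_one, Perm.sumCongr_swap_one, Perm.sumCongr_swap_one]
    exact congrArg₂ _ (congrArg₂ _ (swap_instance_irrel _ _ _ _) (swap_instance_irrel _ _ _ _))
      (swap_instance_irrel _ _ _ _)
  have e₂ : (ofGluing ε hε).rewire (Perm.sumCongr (swap (i, 0) (i, 1) * ihxPerm i j) 1) =
      (ofGluing ε hε).ihxX (Sum.inl (i, 2)) := by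
    rw [ihxX_eq _ _ _ hedge, rewire_rewire]
    refine congrArg (ofGluing ε hε).rewire ?_
    rw [ihxPerm, hm, hm, hm, Perm.sumCongr_swap_one, Perm.sumCongr_swap_one,
      Perm.sumCongr_swap_one]
    exact congrArg₂ _ (swap_instance_irrel _ _ _ _) (congrArg₂ _ (congrArg₂ _
      (swap_instance_irrel _ _ _ _) (swap_instance_irrel _ _ _ _)) (swap_instance_irrel _ _ _ _))
  rw [e₁] at iso₁
  rw [e₂] at iso₂
  rw [iso₁.cls_eq, iso₂.cls_eq]
  have hi : ihxPerm i j (i, 2) = (i, 2) := by simp [ihxPerm_apply hij]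
  have hj : ihxPerm i j (j, 2) = (j, 2) := by simp [ihxPerm_apply hij, hij.symm]
  have hends : ∀ y t, ihxPerm i j (y, t) = (y, t) ∨ ((y = i ∨ y = j) ∧
      ((ihxPerm i j (y, t)).1 = i ∨ (ihxPerm i j (y, t)).1 = j)) := by
    intro y t
    rw [ihxPerm_apply hij]
    split_ifs with h1 h2
    · right; fin_cases t <;> simp [h1]
    · right; fin_cases t <;> simp [h2]
    · exact Or.inl rfl
  apply cls_ihx
  · refine ⟨fun h => ?_, ?_, ?_⟩
    · have h := congrArg Prod.snd (Sum.inl_injective h)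
      simp [turn] at h
    · rw [hedge]
      intro h
      have h := congrArg Prod.snd (Sum.inl_injective h)
      simp [turn] at h
    · rw [hedge]
      refine (sameCycle_vert_iff _ _ _).not.2 ?_
      rintro (h | h | h) <;> exact hij (congrArg Prod.fst (Sum.inl_injective h)).symm
  · rw [← isNLoop_ofGluing_conj_of_ends h₁ hε hε₁ h hi hj hends]
    exact ⟨iso₁.symm.isNLoop, iso₁.isNLoop⟩
  · rw [← isNLoop_ofGluing_conj_of_ends h₂ hε hε₂ h]
    · exact ⟨iso₂.symm.isNLoop, iso₂.isNLoop⟩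
    · simp [hi, swap_apply_def]
    · simp [hj, swap_apply_def]
    · intro y t
      rw [Perm.mul_apply, ihxPerm_apply hij]
      split_ifs with h1 h2
      · right; fin_cases t <;> simp [h1, swap_apply_def, hij.symm]
      · right; fin_cases t <;> simp [h2, swap_apply_def, hij.symm]
      · left
        simp [swap_apply_def, h1]

/-- The rotation by `s` of the three half-edges at the vertex `i`. -/
def rotateAt (i : N) (s : Fin 3) : Perm (N × Fin 3) where
  toFun x := (x.1, if x.1 = i then x.2 + s else x.2)
  invFun x := (x.1, if x.1 = i then x.2 - s else x.2)
  left_inv x := by dsimp only; split_ifs <;> simp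
  right_inv x := by dsimp only; split_ifs <;> simp

theorem rotateAt_apply (i : N) (s : Fin 3) (y : N) (t : Fin 3) :
    rotateAt i s (y, t) = (y, if y = i then t + s else t) := rfl

theorem rotateAt_turn (i : N) (s : Fin 3) (x : N × Fin 3) :
    rotateAt i s (turn N x) = turn N (rotateAt i s x) := by
  obtain ⟨y, t⟩ := x
  simp only [turn_apply, rotateAt_apply]
  split_ifs
  · rw [add_right_comm]
  · rfl

theorem glueCls_conj_rotateAt [Finite N] (i : N) (s : Fin 3) (ε : N × Fin 3 → N × Fin 3) :
    glueCls n (conj (rotateAt i s) ε) = glueCls n ε :=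
  glueCls_conj _ (rotateAt_turn i s) (apply_conj _ _)

theorem glueCls_conj_swap [Finite N] (i : N) (t : Fin 3) (ε : N × Fin 3 → N × Fin 3) :
    glueCls n (conj (swap (i, t) (i, t + 1)) ε) = - glueCls n ε :=
  glueCls_flip i t (apply_conj _ _)

/-- The half-edges at two consecutive vertices `i`, `j` of a path, entering each vertex at its
half-edge `1` and leaving it at `0`, in terms of the half-edges of the "I" with stem
`(i, 2)`, `(j, 2)` in which the path passes only through `i`. -/
def insertAfter (i j : N) : Perm (N × Fin 3) :=
  ihxPerm i j * (rotateAt i 2 * rotateAt j 1)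

/-- The half-edges at two consecutive vertices `j`, `i` of a path, entering each vertex at its
half-edge `1` and leaving it at `0`, in terms of the half-edges of the "I" with stem
`(i, 2)`, `(j, 2)` in which the path passes only through `i`. -/
def insertBefore (i j : N) : Perm (N × Fin 3) :=
  (swap (i, 0) (i, 1) * ihxPerm i j) * (swap (j, 2) (j, 2 + 1) * swap (i, 1) (i, 1 + 1))

theorem insertAfter_apply {i j : N} (hij : i ≠ j) (y : N) (t : Fin 3) :
    insertAfter i j (y, t) = if y = i then ![(i, 2), (i, 1), (j, 0)] t
      else if y = j then ![(i, 0), (j, 2), (j, 1)] t else (y, t) := by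
  by_cases hi : y = i
  · subst hi
    fin_cases t <;> simp [insertAfter, ihxPerm_apply hij, rotateAt_apply, hij]
  · by_cases hj : y = j
    · subst hj
      fin_cases t <;> simp [insertAfter, ihxPerm_apply hij, rotateAt_apply, hij.symm]
    · simp [insertAfter, ihxPerm_apply hij, rotateAt_apply, hi, hj]

theorem insertBefore_apply {i j : N} (hij : i ≠ j) (y : N) (t : Fin 3) :
    insertBefore i j (y, t) = if y = i then ![(i, 0), (i, 2), (j, 0)] t
      else if y = j then ![(j, 2), (i, 1), (j, 1)] t else (y, t) := by
  by_cases hi : y = i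
  · subst hi
    fin_cases t <;> simp [insertBefore, ihxPerm_apply hij, swap_apply_def, hij, hij.symm]
  · by_cases hj : y = j
    · subst hj
      fin_cases t <;> simp [insertBefore, ihxPerm_apply hij, swap_apply_def, hij.symm]
    · simp [insertBefore, ihxPerm_apply hij, swap_apply_def, hi, hj]

/-- The IHX relation for a stem attached to a path: the vertex `j` at the end of the stem is
inserted into the path, either after or before `i`. -/
theorem glueCls_insert [Finite N] {i j : N} (hij : i ≠ j) (h : ε (i, 2) = (j, 2)) :
    glueCls n ε =
      glueCls n (conj (insertAfter i j) ε) - glueCls n (conj (insertBefore i j) ε) := by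
  rw [glueCls_ihx hij h (apply_conj _ _) (apply_conj _ _)]
  rw [insertAfter, insertBefore, conj_mul _ (rotateAt i 2 * _), conj_mul (rotateAt i 2),
    conj_mul _ (swap (j, 2) _ * _), conj_mul (swap (j, 2) _), glueCls_conj_rotateAt,
    glueCls_conj_rotateAt, glueCls_conj_swap, glueCls_conj_swap, neg_neg]

end

/-! ### Wheels -/

section

variable {N : Type} [Finite N] {n : ℕ}

/-- The gluing map of a wheel: a circle through all trivalent vertices in the cyclic order `s`,
entering each vertex at its half-edge `1` and leaving it at `0`, where the remaining half-edges are
joined to each other by the involution `σ`; the fixed points of `σ` are the vertices with a leg. -/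
def wheel (s σ : Perm N) (x : N × Fin 3) : N × Fin 3 :=
  ![(s x.1, 1), (s⁻¹ x.1, 0), (σ x.1, 2)] x.2

theorem wheel_conj (s σ π : Perm N) :
    glueCls n (wheel (π * s * π⁻¹) (π * σ * π⁻¹)) = glueCls n (wheel s σ) := by
  symm
  apply glueCls_relabel π
  rintro ⟨y, t⟩
  fin_cases t <;> simp [wheel]

variable [DecidableEq N]

/-- Reversal of the cyclic orders at the vertices in `S`. -/
def flipOn (S : Finset N) : Perm (N × Fin 3) :=
  Function.Involutive.toPerm (fun x => if x.1 ∈ S then (x.1, swap 0 1 x.2) else x) (by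
    rintro ⟨y, t⟩
    by_cases h : y ∈ S <;> simp [h])

theorem glueCls_conj_flipOn (S : Finset N) (ε : N × Fin 3 → N × Fin 3) :
    glueCls n (conj (flipOn S) ε) = (-1 : ℚ) ^ S.card • glueCls n ε := by
  induction S using Finset.induction_on generalizing ε with
  | empty =>
    have : ε = conj (flipOn ∅) ε := eq_conj fun x => by simp [flipOn]
    simp [← this]
  | insert i S hi ih =>
    have : flipOn (insert i S) = swap (i, 0) (i, 0 + 1) * flipOn S := by
      ext1 ⟨y, t⟩
      by_cases hy : y = i
      · subst hy
        fin_cases t <;> simp [flipOn, hi, swap_apply_def]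
      · by_cases hS : y ∈ S <;> simp [flipOn, hy, hS, swap_apply_def]
    rw [this, conj_mul, ih, glueCls_conj_swap, Finset.card_insert_of_notMem hi, pow_succ]
    simp

theorem wheel_inv (s σ : Perm N) :
    glueCls n (wheel s⁻¹ σ) = (-1 : ℚ) ^ Nat.card N • glueCls n (wheel s σ) := by
  have := Fintype.ofFinite N
  rw [Nat.card_eq_fintype_card, ← Finset.card_univ, ← glueCls_conj_flipOn]
  congr 1
  apply eq_conj
  rintro ⟨y, t⟩
  fin_cases t <;> simp [wheel, flipOn, swap_apply_def]

/-- A gluing map with a circle `s` through all vertices but one, the hub `j`. The three half-edges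
at `j`, and the half-edges `2` at the other vertices, are joined to each other by `κ`. -/
def hub (s : Perm N) (j : N) (κ : N × Fin 3 → N × Fin 3) (x : N × Fin 3) : N × Fin 3 :=
  if x.1 = j then κ x else ![(s x.1, 1), (s⁻¹ x.1, 0), κ x] x.2

/-- If the hub `j` is adjacent to the vertex `i` on the circle, then the IHX relation expands the
diagram into wheels. -/
theorem glueCls_hub {s σ : Perm N} {i j : N} (hij : i ≠ j) (hs : s j = j)
    {κ : N × Fin 3 → N × Fin 3} (hi : κ (i, 2) = (j, 2)) (hj : κ (j, 2) = (i, 2))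
    {u : N → N × Fin 3} (hu : ∀ y, u y = if y = i then (j, 0) else if y = j then (j, 1) else (y, 2))
    (hκ : ∀ y, κ (u y) = u (σ y)) :
    glueCls n (hub s j κ) =
      glueCls n (wheel (s * swap i j) σ) - glueCls n (wheel (swap i j * s) σ) := by
  have hs' : s⁻¹ j = j := by rw [Perm.inv_eq_iff_eq, hs]
  have hne : ∀ y, y ≠ j → s y ≠ j := fun y hy h => hy (s.injective (h.trans hs.symm))
  have hne' : ∀ y, y ≠ j → s⁻¹ y ≠ j := fun y hy h => hy (s⁻¹.injective (h.trans hs'.symm))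
  have hu2 : ∀ y, hub s j κ (u y) = κ (u y) := by
    intro y
    rw [hu]
    split_ifs with h1 h2
    · simp [hub]
    · simp [hub]
    · simp [hub, h2]
  have h2a : ∀ y, insertAfter i j (y, 2) = u y := fun y => by rw [insertAfter_apply hij, hu]; rfl
  have h2b : ∀ y, insertBefore i j (y, 2) = u y := fun y => by
    rw [insertBefore_apply hij, hu]; rfl
  have ha1 : ∀ y, y ≠ j → insertAfter i j (y, 1) = (y, 1) := by
    intro y hy
    rw [insertAfter_apply hij, if_neg hy]
    split_ifs with h <;> simp [h]
  have hb0 : ∀ y, y ≠ j → insertBefore i j (y, 0) = (y, 0) := by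
    intro y hy
    rw [insertBefore_apply hij, if_neg hy]
    split_ifs with h <;> simp [h]
  have ha0 : ∀ y, y ≠ j → insertAfter i j (swap i j y, 0) = (y, 0) := by
    intro y hy
    by_cases h : y = i
    · subst h
      simp [insertAfter_apply hij, hij.symm]
    · rw [swap_apply_of_ne_of_ne h hy, insertAfter_apply hij, if_neg h, if_neg hy]
  have hb1 : ∀ y, y ≠ j → insertBefore i j (swap i j y, 1) = (y, 1) := by
    intro y hy
    by_cases h : y = i
    · subst h
      simp [insertBefore_apply hij, hij.symm]
    · rw [swap_apply_of_ne_of_ne h hy, insertBefore_apply hij, if_neg h, if_neg hy]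
  have hc0 : ∀ y, y ≠ j → hub s j κ (y, 0) = (s y, 1) := fun y hy => by simp [hub, hy]
  have hc1 : ∀ y, y ≠ j → hub s j κ (y, 1) = (s⁻¹ y, 0) := fun y hy => by simp [hub, hy]
  have hi2 : hub s j κ (i, 2) = (j, 2) := by simp [hub, hij, hi]
  have hj2 : hub s j κ (j, 2) = (i, 2) := by simp [hub, hj]
  rw [glueCls_insert hij hi2]
  congr 2
  · symm
    apply eq_conj
    rintro ⟨y, t⟩
    fin_cases t
    · change insertAfter i j (s (swap i j y), 1) = hub s j κ (insertAfter i j (y, 0))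
      by_cases hyi : y = i
      · subst hyi
        rw [swap_apply_left, hs]
        simp [insertAfter_apply hij, hij.symm, hi2]
      · by_cases hyj : y = j
        · subst hyj
          rw [swap_apply_right, ha1 _ (hne _ hij)]
          simp [insertAfter_apply hij, hij.symm, hc0 _ hij]
        · rw [swap_apply_of_ne_of_ne hyi hyj, ha1 _ (hne _ hyj), insertAfter_apply hij,
            if_neg hyi, if_neg hyj, hc0 _ hyj]
    · change insertAfter i j (swap i j (s⁻¹ y), 0) = hub s j κ (insertAfter i j (y, 1))
      by_cases hyj : y = j
      · subst hyj
        rw [hs', swap_apply_right]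
        simp [insertAfter_apply hij, hij.symm, hj2]
      · rw [ha0 _ (hne' _ hyj), ha1 _ hyj, hc1 _ hyj]
    · change insertAfter i j (σ y, 2) = hub s j κ (insertAfter i j (y, 2))
      rw [h2a, h2a, hu2, hκ]
  · symm
    apply eq_conj
    rintro ⟨y, t⟩
    fin_cases t
    · change insertBefore i j (swap i j (s y), 1) = hub s j κ (insertBefore i j (y, 0))
      by_cases hyj : y = j
      · subst hyj
        rw [hs, swap_apply_right]
        simp [insertBefore_apply hij, hij.symm, hj2]
      · rw [hb0 _ hyj, hc0 _ hyj, hb1 _ (hne _ hyj)]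
    · change insertBefore i j (s⁻¹ (swap i j y), 0) = hub s j κ (insertBefore i j (y, 1))
      by_cases hyi : y = i
      · subst hyi
        rw [swap_apply_left, hs']
        simp [insertBefore_apply hij, hij.symm, hi2]
      · by_cases hyj : y = j
        · subst hyj
          rw [swap_apply_right, hb0 _ (hne' _ hij)]
          simp [insertBefore_apply hij, hij.symm, hc1 _ hij]
        · rw [swap_apply_of_ne_of_ne hyi hyj, hb0 _ (hne' _ hyj), insertBefore_apply hij,
            if_neg hyi, if_neg hyj, hc1 _ hyj]
    · change insertBefore i j (σ y, 2) = hub s j κ (insertBefore i j (y, 2))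
      rw [h2b, h2b, hu2, hκ]

/-- Sliding the leg `h` over the two ends `a` and `a'` of a chord. The four diagrams arise by
expanding in two ways the diagram in which the leg is attached to the chord. -/
theorem wheel_slide {s σ : Perm N} {h a a' : N} (hs : s h = h) (hσh : σ h = h) (ha : a ≠ h)
    (ha' : a' ≠ h) (haa : a ≠ a') (hσa : σ a = a') (hσa' : σ a' = a) :
    glueCls n (wheel (s * swap a h) σ) - glueCls n (wheel (swap a h * s) σ) +
      (glueCls n (wheel (s * swap a' h) σ) - glueCls n (wheel (swap a' h * s) σ)) = 0 := by
  have hne : ∀ y, y ≠ h → σ y ≠ h := fun y hy e => hy (σ.injective (e.trans hσh.symm))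
  have hna : ∀ y, y ≠ a' → σ y ≠ a := fun y hy e => hy (σ.injective (e.trans hσa'.symm))
  have hna' : ∀ y, y ≠ a → σ y ≠ a' := fun y hy e => hy (σ.injective (e.trans hσa.symm))
  have e₁ := glueCls_hub (n := n) (s := s) (σ := σ) (i := a) (j := h) ha hs
    (κ := fun x => if x.1 = h then ![(a', 2), (h, 1), (a, 2)] x.2 else
      if x.1 = a then (h, 2) else if x.1 = a' then (h, 0) else (σ x.1, 2))
    (by simp [ha]) (by simp) (fun y => rfl) (fun y => by
      by_cases h1 : y = a
      · subst h1; simp [hσa, haa.symm, ha']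
      by_cases h2 : y = h
      · subst h2; simp [hσh, ha.symm]
      by_cases h3 : y = a'
      · subst h3; simp [hσa', ha', haa.symm]
      simp [h1, h2, h3, hna, hne])
  have e₂ := glueCls_hub (n := n) (s := s) (σ := swap a' h * σ * swap a' h) (i := a') (j := h)
    ha' hs
    (κ := fun x => if x.1 = h then ![(h, 0), (a, 2), (a', 2)] x.2 else
      if x.1 = a' then (h, 2) else if x.1 = a then (h, 1) else (σ x.1, 2))
    (by simp [ha']) (by simp) (fun y => rfl) (fun y => by
      by_cases h1 : y = a'
      · subst h1; simp [hσh]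
      by_cases h2 : y = h
      · subst h2; simp [hσa', ha, ha'.symm, haa, swap_apply_of_ne_of_ne]
      by_cases h3 : y = a
      · subst h3; simp [hσa, ha, haa, ha'.symm, swap_apply_of_ne_of_ne]
      simp [h1, h2, h3, hna', hne, swap_apply_of_ne_of_ne])
  have e₃ : glueCls n (hub s h (fun x => if x.1 = h then ![(a', 2), (h, 1), (a, 2)] x.2 else
      if x.1 = a then (h, 2) else if x.1 = a' then (h, 0) else (σ x.1, 2))) =
      glueCls n (hub s h (fun x => if x.1 = h then ![(h, 0), (a, 2), (a', 2)] x.2 else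
      if x.1 = a' then (h, 2) else if x.1 = a then (h, 1) else (σ x.1, 2))) := by
    symm
    refine glueCls_conj (rotateAt h 1) (rotateAt_turn h 1) ?_
    have hs' : s⁻¹ h = h := by rw [Perm.inv_eq_iff_eq, hs]
    have hneS : ∀ y, y ≠ h → s y ≠ h := fun y hy e => hy (s.injective (e.trans hs.symm))
    have hneS' : ∀ y, y ≠ h → s⁻¹ y ≠ h := fun y hy e => hy (s⁻¹.injective (e.trans hs'.symm))
    rintro ⟨y, t⟩
    by_cases h1 : y = h
    · subst h1
      fin_cases t <;> simp [rotateAt_apply, hub, ha, ha']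
    fin_cases t
    · simp [rotateAt_apply, hub, h1, hneS]
    · have := hneS' y h1
      simp only [Perm.inv_def] at this
      simp [rotateAt_apply, hub, h1, this]
    · by_cases h2 : y = a
      · subst h2
        simp [rotateAt_apply, hub, h1, haa]
      by_cases h3 : y = a'
      · subst h3
        simp [rotateAt_apply, hub, h1, haa.symm]
      simp [rotateAt_apply, hub, h1, h2, h3, hne]
  have hτ : ∀ p : Perm N, glueCls n (wheel p (swap a' h * σ * swap a' h)) =
      glueCls n (wheel (swap a' h * p * swap a' h) σ) := by
    intro p
    rw [← wheel_conj p _ (swap a' h)]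
    congr 2
    simp [mul_assoc]
  rw [e₃, e₂, hτ, hτ] at e₁
  rw [← e₁]
  simp [mul_assoc]

end

/-! ### Words of wheels -/

section

theorem formPerm_map {N : Type*} [DecidableEq N] (π : Perm N) (l : List N) :
    (l.map π).formPerm = π * l.formPerm * π⁻¹ := by
  induction l with
  | nil => simp
  | cons x l ih =>
    cases l with
    | nil => simp
    | cons y l =>
      rw [List.map_cons, List.map_cons, List.formPerm_cons_cons, ← List.map_cons, ih,
        List.formPerm_cons_cons, swap_apply_apply]
      simp [mul_assoc]

theorem formPerm_append_comm {N : Type*} [DecidableEq N] {l₁ l₂ : List N}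
    (h : (l₁ ++ l₂).Nodup) : (l₁ ++ l₂).formPerm = (l₂ ++ l₁).formPerm := by
  rw [← List.formPerm_rotate _ h l₁.length, List.rotate_append_length_eq]

theorem formPerm_insert_before {N : Type*} [DecidableEq N] {l₁ l₂ : List N} {x h : N}
    (hn : (l₁ ++ h :: x :: l₂).Nodup) :
    (l₁ ++ h :: x :: l₂).formPerm = swap x h * (l₁ ++ x :: l₂).formPerm := by
  have hn' : (l₁ ++ x :: l₂).Nodup := by
    refine hn.sublist ?_
    simp
  rw [formPerm_append_comm hn, formPerm_append_comm hn', List.cons_append, List.cons_append,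
    List.formPerm_cons_cons, swap_comm]

theorem formPerm_insert_after {N : Type*} [DecidableEq N] {l₁ l₂ : List N} {x h : N}
    (hn : (l₁ ++ x :: h :: l₂).Nodup) :
    (l₁ ++ x :: h :: l₂).formPerm = (l₁ ++ x :: l₂).formPerm * swap x h := by
  have hn' : (l₂.reverse ++ h :: x :: l₁.reverse).Nodup := by
    simpa using List.nodup_reverse.2 hn
  have := formPerm_insert_before hn'
  rw [← inv_inj, ← List.formPerm_reverse]
  simpa [mul_inv_rev, ← List.formPerm_reverse] using this

variable {N : Type} [DecidableEq N] {n : ℕ}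

/-- The letter by which the vertex `x` of a wheel is recorded: `none` for a vertex with a leg. -/
def letter (σ : Perm N) (x : N) : Option N := if σ x = x then none else some x

theorem letter_eq_some {σ : Perm N} {x y : N} : letter σ x = some y ↔ σ x ≠ x ∧ x = y := by
  unfold letter
  split_ifs with h <;> simp [h]

theorem letter_eq_none {σ : Perm N} {x : N} : letter σ x = none ↔ σ x = x := by
  unfold letter
  split_ifs with h <;> simp [h]

theorem letter_of_ne {σ : Perm N} {x : N} (h : σ x ≠ x) : letter σ x = some x := if_neg h

/-- The list `l` enumerates the vertices, and their letters form the word `w`. -/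
def Spells (σ : Perm N) (l : List N) (w : List (Option N)) : Prop :=
  l.Nodup ∧ (∀ x, x ∈ l) ∧ l.map (letter σ) = w

theorem exists_perm_map_eq {α β : Type*} (f : α → β) {w₁ w₂ : List β} (h : w₁.Perm w₂)
    (l₁ : List α) (h₁ : l₁.map f = w₁) : ∃ l₂, l₁.Perm l₂ ∧ l₂.map f = w₂ := by
  induction h generalizing l₁ with
  | nil => exact ⟨l₁, .refl _, h₁⟩
  | cons x _ ih =>
    obtain ⟨y, l, rfl, rfl, h⟩ := List.map_eq_cons_iff.1 h₁
    obtain ⟨l', hp, rfl⟩ := ih l h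
    exact ⟨y :: l', hp.cons y, rfl⟩
  | swap x y _ =>
    obtain ⟨z, l, rfl, rfl, h⟩ := List.map_eq_cons_iff.1 h₁
    obtain ⟨z', l, rfl, rfl, rfl⟩ := List.map_eq_cons_iff.1 h
    exact ⟨z' :: z :: l, .swap _ _ _, rfl⟩
  | trans _ _ ih₁ ih₂ =>
    obtain ⟨l₂, hp, h₂⟩ := ih₁ l₁ h₁
    obtain ⟨l₃, hp', h₃⟩ := ih₂ l₂ h₂
    exact ⟨l₃, hp.trans hp', h₃⟩

theorem Spells.of_perm {σ : Perm N} {l l' : List N} {w : List (Option N)} (h : Spells σ l w)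
    (hp : l.Perm l') : Spells σ l' (l'.map (letter σ)) :=
  ⟨hp.nodup_iff.1 h.1, fun x => hp.mem_iff.1 (h.2.1 x), rfl⟩

theorem exists_spells_iff_of_perm {σ : Perm N} {w₁ w₂ : List (Option N)} (h : w₁.Perm w₂) :
    (∃ l, Spells σ l w₁) ↔ ∃ l, Spells σ l w₂ := by
  have key : ∀ {w₁ w₂ : List (Option N)}, w₁.Perm w₂ → (∃ l, Spells σ l w₁) →
      ∃ l, Spells σ l w₂ := by
    rintro w₁ w₂ h ⟨l, hl⟩
    obtain ⟨l', hp, rfl⟩ := exists_perm_map_eq _ h l hl.2.2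
    exact ⟨l', hl.of_perm hp⟩
  exact ⟨key h, key h.symm⟩

variable [Finite N]

open Classical in
/-- The class of the wheel with letters `w` in the cyclic order, which is `0` by convention if the
word `w` does not use every chord end exactly once and as many legs as there are. -/
noncomputable def wordCls (n : ℕ) (σ : Perm N) (w : List (Option N)) : NLoopSpace n :=
  if h : ∃ l, Spells σ l w then glueCls n (wheel h.choose.formPerm σ) else 0

theorem wordCls_eq_zero_of_not {σ : Perm N} {w : List (Option N)} (h : ¬ ∃ l, Spells σ l w) :
    wordCls n σ w = 0 := dif_neg h

/-- Wheels with the same word are isomorphic. -/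
theorem wordCls_eq {σ : Perm N} {w : List (Option N)} {l : List N} (h : Spells σ l w) :
    wordCls n σ w = glueCls n (wheel l.formPerm σ) := by
  have h' : ∃ l, Spells σ l w := ⟨l, h⟩
  rw [wordCls, dif_pos h']
  generalize h'.choose = l', h'.choose_spec = hl'
  have hlen : l.length = l'.length := by
    rw [← List.length_map (letter σ), h.2.2, ← hl'.2.2, List.length_map]
  let e : Fin l.length ≃ N := h.1.getEquivOfForallMemList l h.2.1
  let e' : Fin l'.length ≃ N := hl'.1.getEquivOfForallMemList l' hl'.2.1
  let π : Perm N := (e.symm.trans (finCongr hlen)).trans e'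
  have hmap : l.map π = l' := by
    apply List.ext_getElem (by simpa using hlen)
    intro i h₁ h₂
    rw [List.getElem_map]
    have : l[i]'(by simpa using h₁) = e ⟨i, by simpa using h₁⟩ := rfl
    rw [this]
    simp [π, e']
  have hlab : ∀ x, letter σ (π x) = letter σ x := by
    have := h.2.2.trans hl'.2.2.symm
    rw [← hmap, List.map_map] at this
    intro x
    exact (List.map_inj_left.1 this x (h.2.1 x)).symm
  have hπ : ∀ x, σ x ≠ x → π x = x := by
    intro x hx
    have := hlab x
    rw [letter_of_ne hx] at this
    exact (letter_eq_some.1 this).2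
  have hcomm : π * σ * π⁻¹ = σ := by
    rw [mul_inv_eq_iff_eq_mul]
    ext x
    by_cases hx : σ x = x
    · have := hlab x
      rw [letter_eq_none.2 hx, letter_eq_none] at this
      simp [hx, this]
    · have hx' : σ (σ x) ≠ σ x := fun h => hx (σ.injective h)
      simp [hπ _ hx, hπ _ hx']
  rw [← hmap, formPerm_map, ← wheel_conj l.formPerm σ π, hcomm]

theorem wordCls_append_comm (σ : Perm N) (w₁ w₂ : List (Option N)) :
    wordCls n σ (w₁ ++ w₂) = wordCls n σ (w₂ ++ w₁) := by
  by_cases h : ∃ l, Spells σ l (w₁ ++ w₂)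
  · obtain ⟨l, hl⟩ := h
    obtain ⟨l₁, l₂, rfl, rfl, rfl⟩ := List.map_eq_append_iff.1 hl.2.2
    have hl' := hl.of_perm List.perm_append_comm
    rw [List.map_append] at hl'
    rw [wordCls_eq hl, wordCls_eq hl', formPerm_append_comm hl.1]
  · rw [wordCls_eq_zero_of_not h, wordCls_eq_zero_of_not]
    rwa [← exists_spells_iff_of_perm List.perm_append_comm]

theorem wordCls_reverse (hN : Odd (Nat.card N)) (σ : Perm N) (w : List (Option N)) :
    wordCls n σ w.reverse = - wordCls n σ w := by
  by_cases h : ∃ l, Spells σ l w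
  · obtain ⟨l, hl⟩ := h
    have hl' := hl.of_perm l.reverse_perm.symm
    rw [List.map_reverse, hl.2.2] at hl'
    rw [wordCls_eq hl, wordCls_eq hl', List.formPerm_reverse, wheel_inv, hN.neg_one_pow,
      neg_one_smul]
  · rw [wordCls_eq_zero_of_not h, wordCls_eq_zero_of_not, neg_zero]
    rwa [exists_spells_iff_of_perm w.reverse_perm]

theorem wordCls_map {σ π : Perm N} (hπ : π * σ = σ * π) {w : List (Option N)} :
    wordCls n σ (w.map (Option.map π)) = wordCls n σ w := by
  have hlet : ∀ π : Perm N, π * σ = σ * π → ∀ x, letter σ (π x) = Option.map π (letter σ x) := by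
    intro π hπ x
    have : σ (π x) = π (σ x) := (congrArg (fun p : Perm N => p x) hπ).symm
    by_cases hx : σ x = x
    · rw [letter_eq_none.2 hx, Option.map_none, letter_eq_none, this, hx]
    · rw [letter_of_ne hx, letter_of_ne, Option.map_some]
      rw [this]
      exact fun h => hx (π.injective h)
  have hs : ∀ π : Perm N, π * σ = σ * π → ∀ l w, Spells σ l w →
      Spells σ (l.map π) (w.map (Option.map π)) := by
    rintro π hπ l w ⟨h1, h2, rfl⟩
    refine ⟨h1.map π.injective, fun x => List.mem_map.2 ⟨π⁻¹ x, h2 _, π.apply_symm_apply x⟩, ?_⟩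
    simp [hlet π hπ]
  by_cases h : ∃ l, Spells σ l w
  · obtain ⟨l, hl⟩ := h
    rw [wordCls_eq hl, wordCls_eq (hs π hπ l w hl), formPerm_map, ← wheel_conj l.formPerm σ π]
    congr 2
    rw [hπ, mul_inv_cancel_right]
  · rw [wordCls_eq_zero_of_not h, wordCls_eq_zero_of_not]
    rintro ⟨l, hl⟩
    have := hs π⁻¹ (by rw [inv_mul_eq_iff_eq_mul, ← mul_assoc, hπ, mul_inv_cancel_right]) _ _ hl
    rw [List.map_map] at this
    refine h ⟨_, (?_ : Spells σ (l.map (π⁻¹ : Perm N)) w)⟩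
    convert this
    symm
    convert List.map_id w
    ext1 x
    cases x <;> simp

theorem wordCls_slide {σ : Perm N} {a a' : N} (haa : a ≠ a') (ha : σ a = a') (ha' : σ a' = a)
    (w₁ w₂ : List (Option N)) :
    wordCls n σ (some a :: none :: w₁ ++ some a' :: w₂) -
      wordCls n σ (none :: some a :: w₁ ++ some a' :: w₂) +
      (wordCls n σ (some a :: w₁ ++ some a' :: none :: w₂) -
      wordCls n σ (some a :: w₁ ++ none :: some a' :: w₂)) = 0 := by
  have p₁ : (none :: some a :: w₁ ++ some a' :: w₂).Perm
    (some a :: none :: w₁ ++ some a' :: w₂) := List.Perm.swap _ _ _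
  have p₂ : (some a :: w₁ ++ none :: some a' :: w₂).Perm
      (some a :: none :: w₁ ++ some a' :: w₂) := List.Perm.cons _ List.perm_middle
  have p₃ : (some a :: w₁ ++ some a' :: none :: w₂).Perm
      (some a :: none :: w₁ ++ some a' :: w₂) :=
    (List.Perm.append_left _ (List.Perm.swap _ _ _)).trans p₂
  by_cases h : ∃ l, Spells σ l (some a :: none :: w₁ ++ some a' :: w₂)
  swap
  · rw [wordCls_eq_zero_of_not h, wordCls_eq_zero_of_not, wordCls_eq_zero_of_not,
      wordCls_eq_zero_of_not]
    · simp
    · rwa [exists_spells_iff_of_perm p₂]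
    · rwa [exists_spells_iff_of_perm p₃]
    · rwa [exists_spells_iff_of_perm p₁]
  obtain ⟨l, hl⟩ := h
  obtain ⟨l₁, l₂, rfl, e₁, e₂⟩ := List.map_eq_append_iff.1 hl.2.2
  obtain ⟨x, l₁, rfl, hx, e₁⟩ := List.map_eq_cons_iff.1 e₁
  obtain ⟨h, l₁, rfl, hh, rfl⟩ := List.map_eq_cons_iff.1 e₁
  obtain ⟨y, l₂, rfl, hy, rfl⟩ := List.map_eq_cons_iff.1 e₂
  obtain rfl := (letter_eq_some.1 hx).2
  obtain rfl := (letter_eq_some.1 hy).2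
  have hσ := letter_eq_none.1 hh
  have hn := hl.1
  have q₁ : (x :: h :: l₁ ++ y :: l₂).Perm (h :: x :: l₁ ++ y :: l₂) := List.Perm.swap _ _ _
  have q₂ : (x :: h :: l₁ ++ y :: l₂).Perm (x :: l₁ ++ h :: y :: l₂) :=
    (List.Perm.cons _ List.perm_middle).symm
  have q₃ : (x :: h :: l₁ ++ y :: l₂).Perm (x :: l₁ ++ y :: h :: l₂) :=
    q₂.trans (List.Perm.append_left _ (List.Perm.swap _ _ _))
  have s₁ := hl.of_perm q₁
  have s₂ := hl.of_perm q₂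
  have s₃ := hl.of_perm q₃
  simp only [List.map_append, List.map_cons, hx, hy, hh] at s₁ s₂ s₃
  rw [wordCls_eq hl, wordCls_eq s₁, wordCls_eq s₂, wordCls_eq s₃]
  have f₀ := formPerm_insert_after (l₁ := []) hl.1
  have f₁ := formPerm_insert_before (l₁ := []) s₁.1
  have f₂ := formPerm_insert_before s₂.1
  have f₃ := formPerm_insert_after s₃.1
  simp only [List.nil_append, List.append_eq, List.cons_append] at f₀ f₁ f₂ f₃
  simp only [List.cons_append]
  rw [f₀, f₁, f₂, f₃]
  have hnot : h ∉ x :: (l₁ ++ y :: l₂) := by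
    have := s₁.1
    simp only [List.cons_append] at this
    exact (List.nodup_cons.1 this).1
  refine wheel_slide (List.formPerm_apply_of_notMem hnot) hσ ?_ ?_ haa ha ha'
  · rintro rfl; simp at hnot
  · rintro rfl; simp at hnot

end

/-! ### The relations between wheels with two crossed chords -/

section

theorem eq_zero_of_eq_neg {V : Type*} [AddCommGroup V] [Module ℚ V] {x : V} (h : x = -x) :
    x = 0 := by
  have h2 : (2 : ℚ) • x = 0 := by
    rw [two_smul]
    nth_rewrite 2 [h]
    rw [add_neg_cancel]
  exact (smul_eq_zero.1 h2).resolve_left two_ne_zero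

/-- The relations between the wheels with two crossed chords force all of them to vanish. Here
`T k₁ k₂ k₃ k₄` is the wheel with `k₁`, ..., `k₄` legs on the four arcs. Consider the sequence
`T p b c q` with `p + q` and `b`, `c` fixed. By `slide` its increments are values of the difference
`T p (b + 1) c q - T p b (c + 1) q` with a smaller `p + q`, which inductively do not depend on `p`.
By `tripod` the sequence has equal ends, so the increments vanish. Hence legs can be moved freely
between adjacent arcs, and `refl` finishes the proof. -/
theorem eq_zero_of_crossed_relations {V : Type*} [AddCommGroup V] [Module ℚ V]
    {T : ℕ → ℕ → ℕ → ℕ → V} (rot : ∀ k₁ k₂ k₃ k₄, T k₁ k₂ k₃ k₄ = T k₂ k₃ k₄ k₁)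
    (refl : ∀ k₁ k₂ k₃ k₄, T k₁ k₂ k₃ k₄ = - T k₄ k₃ k₂ k₁)
    (slide : ∀ k₁ k₂ k₃ k₄,
      T (k₁ + 1) k₂ k₃ k₄ + T k₁ k₂ (k₃ + 1) k₄ = T k₁ (k₂ + 1) k₃ k₄ + T k₁ k₂ k₃ (k₄ + 1))
    (tripod : ∀ k₂ k₃ k₄, T 0 k₂ k₃ k₄ = T 0 k₄ k₂ k₃) (k₁ k₂ k₃ k₄ : ℕ) :
    T k₁ k₂ k₃ k₄ = 0 := by
  have hE : ∀ p b c q, T (p + 1) b c q - T p b c (q + 1) = T p (b + 1) c q - T p b (c + 1) q := by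
    intro p b c q
    rw [sub_eq_sub_iff_add_eq_add]
    exact slide p b c q
  have ends : ∀ j b c, T j b c 0 = T 0 b c j := fun j b c => by
    rw [tripod b c j, rot 0 j b c]
  have key : ∀ r b c p q, p + q = r → T p (b + 1) c q - T p b (c + 1) q = 0 := by
    intro r
    induction r with
    | zero =>
      intro b c p q h
      obtain ⟨rfl, rfl⟩ : p = 0 ∧ q = 0 := by omega
      rw [← hE, ends, sub_self]
    | succ r ih =>
      intro b c
      have step : ∀ p q, p + q = r → T (p + 1) (b + 1) c q - T (p + 1) b (c + 1) q =
          T p (b + 1) c (q + 1) - T p b (c + 1) (q + 1) := by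
        intro p q h
        have h1 := hE p (b + 1) c q
        have h2 := hE p b (c + 1) q
        rw [ih _ _ _ _ h] at h1 h2
        rw [sub_eq_zero.1 h1, sub_eq_zero.1 h2]
      have const : ∀ p q, p + q = r + 1 → T p (b + 1) c q - T p b (c + 1) q =
          T 0 (b + 1) c (r + 1) - T 0 b (c + 1) (r + 1) := by
        intro p
        induction p with
        | zero => rintro q h; rw [zero_add] at h; rw [h]
        | succ p ihp => intro q h; rw [step p q (by omega), ihp (q + 1) (by omega)]
      -- the differences of consecutive terms of this sequence are all equal, and their sum vanishes
      have hsum := Finset.sum_range_sub (fun i => T i b c (r + 2 - i)) (r + 2)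
      have hterm : ∀ i ∈ Finset.range (r + 2), T (i + 1) b c (r + 2 - (i + 1)) -
          T i b c (r + 2 - i) = T 0 (b + 1) c (r + 1) - T 0 b (c + 1) (r + 1) := by
        intro i hi
        rw [Finset.mem_range] at hi
        rw [← const i (r + 1 - i) (by omega), ← hE]
        congr 2 <;> omega
      rw [Finset.sum_congr rfl hterm, Finset.sum_const, Finset.card_range, Nat.sub_self,
        Nat.sub_zero, ends, sub_self, ← Nat.cast_smul_eq_nsmul ℚ, smul_eq_zero] at hsum
      intro p q h
      rw [const p q h]
      exact hsum.resolve_left (by positivity)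
  have key' : ∀ p b c q, T p (b + 1) c q = T p b (c + 1) q := fun p b c q =>
    sub_eq_zero.1 (key _ _ _ _ _ rfl)
  have move₂ : ∀ b p c q, T p b c q = T p 0 (c + b) q := by
    intro b
    induction b with
    | zero => intros; rfl
    | succ b ih => intro p c q; rw [key', ih, add_right_comm, add_assoc]
  have all : ∀ p b c q, T p b c q = T (p + b + c + q) 0 0 0 := by
    intro p b c q
    calc T p b c q = T 0 (c + b) q p := by rw [move₂ b, rot p]
      _ = T 0 (q + (c + b)) p 0 := by rw [move₂, rot 0 0]
      _ = T 0 (p + (q + (c + b))) 0 0 := by rw [move₂, rot 0 0]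
      _ = T (p + b + c + q) 0 0 0 := by rw [rot]; congr 1; omega
  have h0 := refl k₁ k₂ k₃ k₄
  rw [all k₁, all k₄, show k₄ + k₃ + k₂ + k₁ = k₁ + k₂ + k₃ + k₄ by omega, ← all k₁]
    at h0
  exact eq_zero_of_eq_neg h0

variable {N : Type} [Finite N] [DecidableEq N] {n : ℕ}

/-- Expanding by IHX the diagram in which a tripod with centre `b` has its ends at the points `a`,
`a'`, `b'` of the circle `s`. The rotation of the tripod is a symmetry of the cyclic order at `b`, so
the circle may be replaced by the one in which `a`, `a'`, `b'` are permuted cyclically. -/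
theorem wheel_tripod {s : Perm N} {a a' b b' : N} (hd : [a, a', b, b'].Nodup) (hs : s b = b) :
    glueCls n (wheel (s * swap a b) (swap a a' * swap b b')) -
      glueCls n (wheel (swap a b * s) (swap a a' * swap b b')) =
    glueCls n (wheel (((swap a a' * swap a' b') * s * (swap a a' * swap a' b')⁻¹) * swap a b)
      (swap a a' * swap b b')) -
    glueCls n (wheel (swap a b * ((swap a a' * swap a' b') * s * (swap a a' * swap a' b')⁻¹))
      (swap a a' * swap b b')) := by
  simp only [List.nodup_cons, List.mem_cons, List.not_mem_nil, or_false, not_or,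
    List.nodup_nil, and_true, not_false_eq_true] at hd
  obtain ⟨⟨h1, h2, h3⟩, ⟨h4, h5⟩, h6⟩ := hd
  set κ : N × Fin 3 → N × Fin 3 := fun x => if x.1 = b then ![(a', 2), (b', 2), (a, 2)] x.2 else
      if x.1 = a then (b, 2) else if x.1 = a' then (b, 0) else if x.1 = b' then (b, 1) else
        (x.1, 2) with hκ
  have expand : ∀ p : Perm N, p b = b → glueCls n (hub p b κ) =
      glueCls n (wheel (p * swap a b) (swap a a' * swap b b')) -
      glueCls n (wheel (swap a b * p) (swap a a' * swap b b')) := by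
    intro p hp
    refine glueCls_hub h2 hp (by simp [hκ, h2]) (by simp [hκ]) (fun y => rfl) (fun y => ?_)
    by_cases ha : y = a
    · subst ha
      simp [hκ, swap_apply_def, h2, h3, h4, Ne.symm h1]
    by_cases hb : y = b
    · subst hb
      simp [hκ, swap_apply_def, Ne.symm h2, Ne.symm h3, Ne.symm h5, Ne.symm h6]
    by_cases ha' : y = a'
    · subst ha'
      simp [hκ, swap_apply_def, h4, h5, Ne.symm h1]
    by_cases hb' : y = b'
    · subst hb'
      simp [hκ, swap_apply_def, Ne.symm h3, Ne.symm h2, Ne.symm h5,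
        Ne.symm h6, Ne.symm h4]
    simp [hκ, swap_apply_def, ha, hb, ha', hb']
  set ρ : Perm N := swap a a' * swap a' b' with hρ
  have hρa : ρ a = a' := by simp [hρ, swap_apply_def, h1, h3]
  have hρa' : ρ a' = b' := by simp [hρ, swap_apply_def, Ne.symm h3, Ne.symm h5]
  have hρb' : ρ b' = a := by simp [hρ]
  have hρo : ∀ y, y ≠ a → y ≠ a' → y ≠ b' → ρ y = y := by
    intro y q1 q2 q3
    simp [hρ, swap_apply_def, q1, q2, q3]
  have hρb : ρ b = b := hρo b (Ne.symm h2) (Ne.symm h4) h6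
  have hρb₁ : ρ⁻¹ b = b := by rw [Perm.inv_eq_iff_eq, hρb]
  have hp : (ρ * s * ρ⁻¹) b = b := by rw [Perm.mul_apply, Perm.mul_apply, hρb₁, hs, hρb]
  rw [← expand s hs, ← expand _ hp]
  -- renaming the vertices by `ρ` and rotating the hub preserves the cyclic orders
  have hne : ∀ y, y ≠ b → ρ y ≠ b := fun y hy e => hy (ρ.injective (e.trans hρb.symm))
  refine glueCls_conj (rotateAt b 1 * ρ.prodCongr (Equiv.refl _)) ?_ ?_
  · intro x
    rw [Perm.mul_apply, Perm.mul_apply, ← rotateAt_turn]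
    rfl
  have happ : ∀ y t, (rotateAt b 1 * ρ.prodCongr (Equiv.refl _) : Perm (N × Fin 3)) (y, t) =
      (ρ y, if ρ y = b then t + 1 else t) := fun y t => rfl
  have hsb : ∀ y, y ≠ b → s y ≠ b := fun y hy e => hy (s.injective (e.trans hs.symm))
  have hs' : s⁻¹ b = b := by rw [Perm.inv_eq_iff_eq, hs]
  have hsb' : ∀ y, y ≠ b → s⁻¹ y ≠ b := fun y hy e => hy (s⁻¹.injective (e.trans hs'.symm))
  rintro ⟨y, t⟩
  by_cases hb : y = b
  · subst hb
    rw [happ _ t, hρb, if_pos rfl]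
    fin_cases t
    · simp [hub, hκ, happ, hρa', Ne.symm h6]
    · simp [hub, hκ, happ, hρb', h2]
    · simp [hub, hκ, happ, hρa, h4]
  rw [happ _ t, if_neg (hne y hb)]
  have hub0 : ∀ p : Perm N, ∀ y, y ≠ b → hub p b κ (y, 0) = (p y, 1) := fun p y hy => by
    simp [hub, hy]
  have hub1 : ∀ p : Perm N, ∀ y, y ≠ b → hub p b κ (y, 1) = (p⁻¹ y, 0) := fun p y hy => by
    simp [hub, hy]
  have hub2 : ∀ p : Perm N, ∀ y, y ≠ b → hub p b κ (y, 2) = κ (y, 2) := fun p y hy => by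
    simp [hub, hy]
  fin_cases t
  · change (rotateAt b 1 * ρ.prodCongr (Equiv.refl _) : Perm (N × Fin 3)) (hub s b κ (y, 0)) =
      hub _ b κ (ρ y, 0)
    rw [hub0 _ _ hb, hub0 _ _ (hne y hb), happ, if_neg (hne _ (hsb y hb))]
    simp
  · change (rotateAt b 1 * ρ.prodCongr (Equiv.refl _) : Perm (N × Fin 3)) (hub s b κ (y, 1)) =
      hub _ b κ (ρ y, 1)
    rw [hub1 _ _ hb, hub1 _ _ (hne y hb), happ, if_neg (hne _ (hsb' y hb))]
    simp [mul_assoc]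
  · change (rotateAt b 1 * ρ.prodCongr (Equiv.refl _) : Perm (N × Fin 3)) (hub s b κ (y, 2)) =
      hub _ b κ (ρ y, 2)
    rw [hub2 _ _ hb, hub2 _ _ (hne y hb)]
    by_cases ha : y = a
    · subst ha
      simp [hκ, happ, hρa, hρb, h2, h4, Ne.symm h1]
    by_cases ha' : y = a'
    · subst ha'
      simp [hκ, happ, hρa', hρb, h4, Ne.symm h1, Ne.symm h3, Ne.symm h5, Ne.symm h6]
    by_cases hb' : y = b'
    · subst hb'
      simp [hκ, happ, hρb', hρb, h2, Ne.symm h3, Ne.symm h5, Ne.symm h6]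
    rw [hρo y ha ha' hb']
    simp [hκ, happ, hb, ha, ha', hb', hρo y ha ha' hb']

end

/-! ### Wheels with two chords vanish -/

section

theorem swap_mul_swap_apply {N : Type} [DecidableEq N] {a a' b b' : N} (hd : [a, a', b, b'].Nodup) :
    (swap a a' * swap b b') a = a' ∧ (swap a a' * swap b b') a' = a ∧
      (swap a a' * swap b b') b = b' ∧ (swap a a' * swap b b') b' = b := by
  simp only [List.nodup_cons, List.mem_cons, List.not_mem_nil, or_false, not_or,
    List.nodup_nil, and_true, not_false_eq_true] at hd
  obtain ⟨⟨h1, h2, h3⟩, ⟨h4, h5⟩, h6⟩ := hd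
  simp [swap_apply_def, h2, h3, h4, h5, Ne.symm h2, Ne.symm h4, Ne.symm h3,
    Ne.symm h5]

variable {N : Type}

/-- An arc of a wheel which carries `k` legs and no chord ends. -/
def arc (N : Type) (k : ℕ) : List (Option N) := List.replicate k none

theorem arc_succ_append (k : ℕ) (w : List (Option N)) :
    arc N k ++ none :: w = none :: (arc N k ++ w) := by
  induction k with
  | zero => rfl
  | succ k ih => simpa [arc, List.replicate_succ] using ih

variable [Finite N] [DecidableEq N] {n : ℕ}

/-- The class of the wheel with the four chord ends `x₁`, ..., `x₄` in this cyclic order, where `kᵢ`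
legs follow `xᵢ`. How the ends are joined is determined by `σ`: the chords are crossed if they are
`x₁ x₃` and `x₂ x₄`, and parallel otherwise. -/
noncomputable def fourCls (n : ℕ) (σ : Perm N) (x₁ x₂ x₃ x₄ : N) (k₁ k₂ k₃ k₄ : ℕ) : NLoopSpace n :=
  wordCls n σ (some x₁ :: arc N k₁ ++ (some x₂ :: arc N k₂ ++ (some x₃ :: arc N k₃ ++
    (some x₄ :: arc N k₄))))

theorem fourCls_rotate (σ : Perm N) (x₁ x₂ x₃ x₄ : N) (k₁ k₂ k₃ k₄ : ℕ) :
    fourCls n σ x₁ x₂ x₃ x₄ k₁ k₂ k₃ k₄ = fourCls n σ x₂ x₃ x₄ x₁ k₂ k₃ k₄ k₁ := by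
  rw [fourCls, wordCls_append_comm]
  simp [fourCls]

theorem fourCls_reverse (hN : Odd (Nat.card N)) (σ : Perm N) (x₁ x₂ x₃ x₄ : N) (k₁ k₂ k₃ k₄ : ℕ) :
    fourCls n σ x₁ x₂ x₃ x₄ k₁ k₂ k₃ k₄ = - fourCls n σ x₁ x₄ x₃ x₂ k₄ k₃ k₂ k₁ := by
  rw [← neg_eq_iff_eq_neg, fourCls, ← wordCls_reverse hN]
  have h : (some x₁ :: arc N k₁ ++ (some x₂ :: arc N k₂ ++ (some x₃ :: arc N k₃ ++
    (some x₄ :: arc N k₄)))).reverse = (arc N k₄ ++ (some x₄ :: arc N k₃ ++ (some x₃ :: arc N k₂ ++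
      (some x₂ :: arc N k₁)))) ++ [some x₁] := by
    simp [arc]
  rw [h, wordCls_append_comm]
  simp [fourCls]

theorem fourCls_map {σ π : Perm N} (hπ : π * σ = σ * π) (x₁ x₂ x₃ x₄ : N) (k₁ k₂ k₃ k₄ : ℕ) :
    fourCls n σ x₁ x₂ x₃ x₄ k₁ k₂ k₃ k₄ =
      fourCls n σ (π x₁) (π x₂) (π x₃) (π x₄) k₁ k₂ k₃ k₄ := by
  rw [fourCls, ← wordCls_map hπ]
  simp [fourCls, arc]

/-- Sliding a leg over the chord `x₁ x₃`, which separates the arcs `k₄`, `k₁` at one end and `k₂`,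
`k₃` at the other. -/
theorem fourCls_slide_crossed {σ : Perm N} {x₁ x₂ x₃ x₄ : N} (hne : x₁ ≠ x₃) (h₁ : σ x₁ = x₃)
    (h₃ : σ x₃ = x₁) (k₁ k₂ k₃ k₄ : ℕ) :
    fourCls n σ x₁ x₂ x₃ x₄ (k₁ + 1) k₂ k₃ k₄ + fourCls n σ x₁ x₂ x₃ x₄ k₁ k₂ (k₃ + 1) k₄ =
      fourCls n σ x₁ x₂ x₃ x₄ k₁ (k₂ + 1) k₃ k₄ + fourCls n σ x₁ x₂ x₃ x₄ k₁ k₂ k₃ (k₄ + 1) := by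
  have h := wordCls_slide (n := n) hne h₁ h₃ (arc N k₁ ++ some x₂ :: arc N k₂)
    (arc N k₃ ++ some x₄ :: arc N k₄)
  have e₁ : fourCls n σ x₁ x₂ x₃ x₄ (k₁ + 1) k₂ k₃ k₄ = wordCls n σ (some x₁ :: none ::
      (arc N k₁ ++ some x₂ :: arc N k₂) ++ some x₃ :: (arc N k₃ ++ some x₄ :: arc N k₄)) := by
    simp [fourCls, arc, List.replicate_succ]
  have e₂ : fourCls n σ x₁ x₂ x₃ x₄ k₁ k₂ (k₃ + 1) k₄ = wordCls n σ (some x₁ ::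
      (arc N k₁ ++ some x₂ :: arc N k₂) ++ some x₃ :: none ::
        (arc N k₃ ++ some x₄ :: arc N k₄)) := by
    simp [fourCls, arc, List.replicate_succ]
  have e₃ : fourCls n σ x₁ x₂ x₃ x₄ k₁ (k₂ + 1) k₃ k₄ = wordCls n σ (some x₁ ::
      (arc N k₁ ++ some x₂ :: arc N k₂) ++ none :: some x₃ ::
        (arc N k₃ ++ some x₄ :: arc N k₄)) := by
    simp [fourCls, arc, List.replicate_succ']
  have e₄ : fourCls n σ x₁ x₂ x₃ x₄ k₁ k₂ k₃ (k₄ + 1) = wordCls n σ (none :: some x₁ ::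
      (arc N k₁ ++ some x₂ :: arc N k₂) ++ some x₃ :: (arc N k₃ ++ some x₄ :: arc N k₄)) := by
    rw [List.cons_append, ← List.singleton_append, wordCls_append_comm]
    simp [fourCls, arc, List.replicate_succ']
  rw [← e₁, ← e₂, ← e₃, ← e₄] at h
  rw [← sub_eq_zero, ← h]
  abel

/-- Sliding a leg over the chord `x₁ x₂`: the two wheels with the leg on the arc cut off by the
chord cancel each other. -/
theorem fourCls_slide_parallel {σ : Perm N} {x₁ x₂ x₃ x₄ : N} (hne : x₁ ≠ x₂) (h₁ : σ x₁ = x₂)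
    (h₂ : σ x₂ = x₁) (k₁ k₂ k₃ k₄ : ℕ) :
    fourCls n σ x₁ x₂ x₃ x₄ k₁ (k₂ + 1) k₃ k₄ = fourCls n σ x₁ x₂ x₃ x₄ k₁ k₂ k₃ (k₄ + 1) := by
  have h := wordCls_slide (n := n) hne h₁ h₂ (arc N k₁)
    (arc N k₂ ++ (some x₃ :: arc N k₃ ++ some x₄ :: arc N k₄))
  have e₁ : fourCls n σ x₁ x₂ x₃ x₄ k₁ (k₂ + 1) k₃ k₄ = wordCls n σ (some x₁ :: arc N k₁ ++
      some x₂ :: none :: (arc N k₂ ++ (some x₃ :: arc N k₃ ++ some x₄ :: arc N k₄))) := by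
    simp [fourCls, arc, List.replicate_succ]
  have e₂ : fourCls n σ x₁ x₂ x₃ x₄ k₁ k₂ k₃ (k₄ + 1) = wordCls n σ (none :: some x₁ :: arc N k₁ ++
      some x₂ :: (arc N k₂ ++ (some x₃ :: arc N k₃ ++ some x₄ :: arc N k₄))) := by
    rw [List.cons_append, ← List.singleton_append, wordCls_append_comm]
    simp [fourCls, arc, List.replicate_succ']
  have e₃ : (some x₁ :: arc N k₁ ++
      none :: some x₂ :: (arc N k₂ ++ (some x₃ :: arc N k₃ ++ some x₄ :: arc N k₄))) =
      (some x₁ :: none :: arc N k₁ ++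
      some x₂ :: (arc N k₂ ++ (some x₃ :: arc N k₃ ++ some x₄ :: arc N k₄))) := by
    rw [List.cons_append, arc_succ_append]
    rfl
  rw [← e₁, ← e₂, e₃] at h
  rw [← sub_eq_zero, ← h]
  abel

/-- Wheels with two parallel chords vanish: a leg may be moved from one of the two arcs between the
chords to the other, and the reflection which exchanges these arcs reverses an odd number of cyclic
orders. -/
theorem fourCls_parallel_eq_zero (hN : Odd (Nat.card N)) {σ : Perm N} (hσ : ∀ x, σ (σ x) = x)
    {x₁ x₂ x₃ x₄ : N} (hne : x₁ ≠ x₂) (h₁ : σ x₁ = x₂) (h₃ : σ x₃ = x₄) (k₁ k₂ k₃ k₄ : ℕ) :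
    fourCls n σ x₁ x₂ x₃ x₄ k₁ k₂ k₃ k₄ = 0 := by
  have h₂ : σ x₂ = x₁ := by rw [← h₁, hσ]
  have h₄ : σ x₄ = x₃ := by rw [← h₃, hσ]
  have move : ∀ k₂ k₄, fourCls n σ x₁ x₂ x₃ x₄ k₁ k₂ k₃ k₄ =
      fourCls n σ x₁ x₂ x₃ x₄ k₁ 0 k₃ (k₂ + k₄) := by
    intro k₂
    induction k₂ with
    | zero => intro k₄; rw [zero_add]
    | succ k₂ ih =>
      intro k₄
      rw [fourCls_slide_parallel hne h₁ h₂, ih, add_right_comm, add_assoc]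
  apply eq_zero_of_eq_neg
  conv_lhs =>
    rw [fourCls_reverse hN, fourCls_map (rfl : σ * σ = σ * σ), h₁, h₂, h₃, h₄, fourCls_rotate,
      fourCls_rotate, fourCls_rotate, move, add_comm, ← move]

/-- The IHX relation at two ends of different chords: the third diagram is symmetric under a cyclic
permutation of three of the arcs. -/
theorem fourCls_tripod {a a' b b' : N} (hd : [a, a', b, b'].Nodup) (k₂ k₃ k₄ : ℕ) :
    fourCls n (swap a a' * swap b b') a b a' b' 0 k₂ k₃ k₄ -
      fourCls n (swap a a' * swap b b') b a a' b' 0 k₂ k₃ k₄ =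
    fourCls n (swap a a' * swap b b') a b a' b' 0 k₄ k₂ k₃ -
      fourCls n (swap a a' * swap b b') b a a' b' 0 k₄ k₂ k₃ := by
  by_cases h : ∃ l, Spells (swap a a' * swap b b') l (some a :: arc N 0 ++ (some b :: arc N k₂ ++
    (some a' :: arc N k₃ ++ (some b' :: arc N k₄))))
  swap
  · have hz : ∀ w : List (Option N), (some a :: arc N 0 ++ (some b :: arc N k₂ ++
        (some a' :: arc N k₃ ++ (some b' :: arc N k₄)))).Perm w →
        wordCls n (swap a a' * swap b b') w = 0 := fun w hw =>
      wordCls_eq_zero_of_not (by rwa [← exists_spells_iff_of_perm hw])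
    simp only [fourCls]
    rw [hz, hz, hz, hz]
    all_goals
      rw [List.perm_iff_count]
      intro y
      simp only [List.count_append, List.count_cons]
      try omega
  obtain ⟨l, hl⟩ := h
  obtain ⟨l₁, l, rfl, e₁, f₁⟩ := List.map_eq_append_iff.1 hl.2.2
  obtain ⟨x, l₁, rfl, hx, e₁⟩ := List.map_eq_cons_iff.1 e₁
  obtain rfl := List.map_eq_nil_iff.1 e₁
  obtain ⟨l₂, l, rfl, e₂, f₂⟩ := List.map_eq_append_iff.1 f₁
  obtain ⟨y, l₂, rfl, hy, e₂⟩ := List.map_eq_cons_iff.1 e₂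
  obtain ⟨l₃, l₄, rfl, e₃, e₄⟩ := List.map_eq_append_iff.1 f₂
  obtain ⟨x', l₃, rfl, hx', e₃⟩ := List.map_eq_cons_iff.1 e₃
  obtain ⟨y', l₄, rfl, hy', e₄⟩ := List.map_eq_cons_iff.1 e₄
  obtain rfl := (letter_eq_some.1 hx).2
  obtain rfl := (letter_eq_some.1 hy).2
  obtain rfl := (letter_eq_some.1 hx').2
  obtain rfl := (letter_eq_some.1 hy').2
  have spell : ∀ l', ([x] ++ (y :: l₂ ++ (x' :: l₃ ++ y' :: l₄))).Perm l' →
      wordCls n (swap x x' * swap y y') (l'.map (letter (swap x x' * swap y y'))) =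
        glueCls n (wheel l'.formPerm (swap x x' * swap y y')) := fun l' hp =>
    wordCls_eq (hl.of_perm hp)
  have nodup : ∀ l', ([x] ++ (y :: l₂ ++ (x' :: l₃ ++ y' :: l₄))).Perm l' → l'.Nodup :=
    fun l' hp => (hl.of_perm hp).1
  have p₁ := List.Perm.refl ([x] ++ (y :: l₂ ++ (x' :: l₃ ++ y' :: l₄)))
  have p₂ : ([x] ++ (y :: l₂ ++ (x' :: l₃ ++ y' :: l₄))).Perm
      ([y] ++ (x :: l₂ ++ (x' :: l₃ ++ y' :: l₄))) := List.Perm.swap _ _ _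
  have p₃ : ([x] ++ (y :: l₂ ++ (x' :: l₃ ++ y' :: l₄))).Perm
      ([x] ++ (y :: l₄ ++ (x' :: l₂ ++ y' :: l₃))) := by
    rw [List.perm_iff_count]
    intro y
    simp only [List.count_append, List.count_cons]
    omega
  have p₄ : ([x] ++ (y :: l₂ ++ (x' :: l₃ ++ y' :: l₄))).Perm
      ([y] ++ (x :: l₄ ++ (x' :: l₂ ++ y' :: l₃))) := p₃.trans (List.Perm.swap y x _)
  have s₁ := spell _ p₁
  have s₂ := spell _ p₂
  have s₃ := spell _ p₃
  have s₄ := spell _ p₄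
  have n₁ := nodup _ p₁
  have n₂ := nodup _ p₂
  have n₃ := nodup _ p₃
  simp only [List.map_append, List.map_cons, List.map_nil, hx, hy, hx', hy', e₂, e₃, e₄]
    at s₁ s₂ s₃ s₄
  have w₁ : ∀ c₁ c₂ c₃ c₄ m₂ m₃ m₄, fourCls n (swap x x' * swap y y') c₁ c₂ c₃ c₄ 0 m₂ m₃ m₄ =
      wordCls n (swap x x' * swap y y') ([some c₁] ++ (some c₂ :: arc N m₂ ++
        (some c₃ :: arc N m₃ ++ some c₄ :: arc N m₄))) := fun c₁ c₂ c₃ c₄ m₂ m₃ m₄ => rfl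
  -- without the vertex `y`, the renaming `ρ` of the vertices turns the first circle into the second
  set ρ : Perm N := swap x x' * swap x' y' with hρ
  have hd' := hd
  simp only [List.nodup_cons, List.mem_cons, List.not_mem_nil, or_false, not_or,
    List.nodup_nil, and_true, not_false_eq_true] at hd'
  obtain ⟨⟨h1, h2, h3⟩, ⟨h4, h5⟩, h6⟩ := hd'
  have hfix : ∀ (k : ℕ) (l : List N), l.map (letter (swap x x' * swap y y')) = arc N k →
      l.map ρ = l := by
    intro k l hl
    conv_rhs => rw [← List.map_id l]
    refine List.map_congr_left fun z hz => ?_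
    have hz' : letter (swap x x' * swap y y') z = none := by
      have := List.mem_map_of_mem (f := letter (swap x x' * swap y y')) hz
      rw [hl] at this
      exact List.eq_of_mem_replicate this
    rw [letter_eq_none] at hz'
    have z1 : z ≠ x := by rintro rfl; simp [swap_apply_def, h2, h3, Ne.symm h1] at hz'
    have z2 : z ≠ x' := by rintro rfl; simp [swap_apply_def, h4, h5, h1] at hz'
    have z3 : z ≠ y' := by
      rintro rfl; simp [swap_apply_def, Ne.symm h4, Ne.symm h2, h6] at hz'
    simp [hρ, swap_apply_def, z1, z2, z3]
  have hmap : ((x :: (l₂ ++ (x' :: l₃ ++ y' :: l₄))).map ρ) =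
      (x' :: l₂ ++ y' :: l₃) ++ (x :: l₄) := by
    have r1 : ρ x = x' := by simp [hρ, swap_apply_def, h1, h3]
    have r2 : ρ x' = y' := by simp [hρ, swap_apply_def, Ne.symm h3, Ne.symm h5]
    have r3 : ρ y' = x := by simp [hρ]
    simp [hfix _ _ e₂, hfix _ _ e₃, hfix _ _ e₄, r1, r2, r3]
  have n₀ : (x :: (l₂ ++ (x' :: l₃ ++ y' :: l₄))).Nodup := n₁.sublist (by simp)
  have hy₀ : (x :: (l₂ ++ (x' :: l₃ ++ y' :: l₄))).formPerm y = y :=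
    List.formPerm_apply_of_notMem (List.nodup_cons.1 n₂).1
  have g := wheel_tripod (n := n) hd hy₀
  rw [← formPerm_map, hmap, formPerm_append_comm (hmap ▸ n₀.map ρ.injective)] at g
  rw [w₁, w₁, w₁, w₁, s₁, s₂, s₃, s₄]
  have n₄ := nodup _ p₄
  refine (congrArg₂ (fun p q => glueCls n (wheel p _) - glueCls n (wheel q _))
    (formPerm_insert_after (l₁ := []) n₁) (formPerm_insert_before (l₁ := []) n₂)).trans (g.trans ?_)
  exact (congrArg₂ (fun p q => glueCls n (wheel p _) - glueCls n (wheel q _))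
    (formPerm_insert_after (l₁ := []) n₃) (formPerm_insert_before (l₁ := []) n₄)).symm

/-- Wheels with two crossed chords and an odd number of trivalent vertices vanish. -/
theorem fourCls_crossed_eq_zero (hN : Odd (Nat.card N)) {a a' b b' : N}
    (hd : [a, a', b, b'].Nodup) (k₁ k₂ k₃ k₄ : ℕ) :
    fourCls n (swap a a' * swap b b') a b a' b' k₁ k₂ k₃ k₄ = 0 := by
  obtain ⟨ha, ha', hb, hb'⟩ := swap_mul_swap_apply hd
  have hd' := hd
  simp only [List.nodup_cons, List.mem_cons, List.not_mem_nil, or_false, not_or,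
    List.nodup_nil, and_true, not_false_eq_true] at hd'
  obtain ⟨⟨h1, h2, h3⟩, ⟨h4, h5⟩, h6⟩ := hd'
  set σ := swap a a' * swap b b' with hσ
  have hσo : ∀ x, x ≠ a → x ≠ a' → x ≠ b → x ≠ b' → σ x = x := by
    intro x xa xa' xb xb'
    simp [hσ, swap_apply_def, xa, xa', xb, xb']
  have hσσ : ∀ x, σ (σ x) = x := by
    intro x
    by_cases xa : x = a
    · rw [xa, ha, ha']
    by_cases xa' : x = a'
    · rw [xa', ha', ha]
    by_cases xb : x = b
    · rw [xb, hb, hb']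
    by_cases xb' : x = b'
    · rw [xb', hb', hb]
    rw [hσo x xa xa' xb xb', hσo x xa xa' xb xb']
  have hcomm : ∀ π : Perm N, (∀ x, x ≠ a → x ≠ a' → x ≠ b → x ≠ b' → π x = x) →
      π a' = σ (π a) → π b' = σ (π b) → π * σ = σ * π := by
    intro π hπ e₁ e₂
    ext x
    change π (σ x) = σ (π x)
    by_cases xa : x = a
    · rw [xa, ha, e₁]
    by_cases xa' : x = a'
    · rw [xa', ha', e₁, hσσ]
    by_cases xb : x = b
    · rw [xb, hb, e₂]
    by_cases xb' : x = b'
    · rw [xb', hb', e₂, hσσ]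
    rw [hσo x xa xa' xb xb', hπ x xa xa' xb xb', hσo x xa xa' xb xb']
  refine eq_zero_of_crossed_relations (fun k₁ k₂ k₃ k₄ => ?_) (fun k₁ k₂ k₃ k₄ => ?_)
    (fun k₁ k₂ k₃ k₄ => fourCls_slide_crossed h1 ha ha' k₁ k₂ k₃ k₄)
    (fun k₂ k₃ k₄ => ?_) k₁ k₂ k₃ k₄
  · -- the renaming `a ↦ b' ↦ a' ↦ b ↦ a` of the vertices turns each chord into the other
    set π : Perm N := swap a b' * (swap b' a' * swap a' b) with hπ
    have q₁ : π a = b' := by simp [hπ, swap_apply_def, h1, h2, h3]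
    have q₂ : π b' = a' := by
      simp [hπ, swap_apply_def, Ne.symm h6, Ne.symm h5, Ne.symm h1, h5]
    have q₃ : π a' = b := by
      simp [hπ, swap_apply_def, Ne.symm h4, Ne.symm h2, h6]
    have q₄ : π b = a := by simp [hπ]
    have hc : π * σ = σ * π := by
      refine hcomm π (fun x xa xa' xb xb' => ?_) ?_ ?_
      · simp [hπ, swap_apply_def, xa, xa', xb, xb']
      · rw [q₁, q₃, hb']
      · rw [q₂, q₄, ha]
    rw [fourCls_rotate, fourCls_map hc, q₁, q₂, q₃, q₄]
  · have q₁ : swap b b' a = a := swap_apply_of_ne_of_ne h2 h3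
    have q₂ : swap b b' a' = a' := swap_apply_of_ne_of_ne h4 h5
    have hc : swap b b' * σ = σ * swap b b' := by
      refine hcomm _ (fun x xa xa' xb xb' => swap_apply_of_ne_of_ne xb xb') ?_ ?_
      · rw [q₁, q₂, ha]
      · rw [swap_apply_left, swap_apply_right, hb']
    rw [fourCls_reverse hN, fourCls_map hc, q₁, q₂, swap_apply_left, swap_apply_right]
  · have h := fourCls_tripod (n := n) hd k₂ k₃ k₄
    rwa [fourCls_rotate _ b, fourCls_rotate _ b, fourCls_parallel_eq_zero hN hσσ h1 ha hb',
      fourCls_parallel_eq_zero hN hσσ h1 ha hb', sub_zero, sub_zero] at h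

end

/-! ### Recognizing the two chords of a wheel -/

section

variable {N : Type} [Finite N] [DecidableEq N] {n : ℕ}

theorem glueCls_wheel_eq_fourCls {σ : Perm N} {x₁ x₂ x₃ x₄ : N} {l₁ l₂ l₃ l₄ : List N}
    (hn : (x₁ :: l₁ ++ (x₂ :: l₂ ++ (x₃ :: l₃ ++ (x₄ :: l₄)))).Nodup)
    (hc : ∀ x, x ∈ x₁ :: l₁ ++ (x₂ :: l₂ ++ (x₃ :: l₃ ++ (x₄ :: l₄))))
    (hσ : ∀ x, σ x ≠ x ↔ x = x₁ ∨ x = x₂ ∨ x = x₃ ∨ x = x₄) :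
    glueCls n (wheel (x₁ :: l₁ ++ (x₂ :: l₂ ++ (x₃ :: l₃ ++ (x₄ :: l₄)))).formPerm σ) =
      fourCls n σ x₁ x₂ x₃ x₄ l₁.length l₂.length l₃.length l₄.length := by
  have harc : ∀ l : List N, (∀ z ∈ l, z ≠ x₁ ∧ z ≠ x₂ ∧ z ≠ x₃ ∧ z ≠ x₄) →
      l.map (letter σ) = arc N l.length := by
    intro l hl
    rw [arc, List.eq_replicate_iff]
    refine ⟨List.length_map _, fun y hy => ?_⟩
    obtain ⟨z, hz, rfl⟩ := List.mem_map.1 hy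
    rw [letter_eq_none]
    by_contra h
    have := hl z hz
    have := (hσ z).1 h
    tauto
  symm
  refine wordCls_eq ⟨hn, hc, ?_⟩
  have h₁ := letter_of_ne ((hσ x₁).2 (by simp))
  have h₂ := letter_of_ne ((hσ x₂).2 (by simp))
  have h₃ := letter_of_ne ((hσ x₃).2 (by simp))
  have h₄ := letter_of_ne ((hσ x₄).2 (by simp))
  simp only [List.map_append, List.map_cons, h₁, h₂, h₃, h₄]
  rw [harc l₁, harc l₂, harc l₃, harc l₄]
  all_goals
    intro z hz
    have hcount := List.nodup_iff_count_le_one.1 hn z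
    have hpos := List.count_pos_iff.2 hz
    simp only [List.count_append, List.count_cons] at hcount
    refine ⟨?_, ?_, ?_, ?_⟩ <;> rintro rfl <;> simp only [beq_self_eq_true, if_true] at hcount <;>
      omega

theorem exists_split_pair {α : Type*} {x y : α} {l : List α} (hxy : x ≠ y) (hx : x ∈ l)
    (hy : y ∈ l) : ∃ l₁ l₂ l₃, l = l₁ ++ x :: (l₂ ++ y :: l₃) ∨ l = l₁ ++ y :: (l₂ ++ x :: l₃) := by
  obtain ⟨u, v, rfl⟩ := List.append_of_mem hx
  rcases List.mem_append.1 hy with h | h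
  · obtain ⟨s, t, rfl⟩ := List.append_of_mem h
    exact ⟨s, t, v, Or.inr (by simp)⟩
  · obtain ⟨s, t, rfl⟩ := List.append_of_mem (List.mem_of_ne_of_mem hxy.symm h)
    exact ⟨u, s, t, Or.inl rfl⟩

theorem exists_two_chords {σ : Perm N} (hσ : ∀ x, σ (σ x) = x)
    (hfix : Nat.card N = Nat.card {x // σ x = x} + 4) :
    ∃ a a' b b' : N, [a, a', b, b'].Nodup ∧ σ = swap a a' * swap b b' ∧
      ∀ x, σ x ≠ x ↔ x = a ∨ x = a' ∨ x = b ∨ x = b' := by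
  have := Fintype.ofFinite N
  have hcard : (Finset.univ.filter fun x => σ x ≠ x).card = 4 := by
    have h := Finset.card_filter_add_card_filter_not (s := (Finset.univ : Finset N))
      (fun x => σ x = x)
    have hk : Nat.card {x // σ x = x} = (Finset.univ.filter fun x => σ x = x).card := by
      rw [Nat.card_eq_fintype_card, Fintype.card_subtype]
    rw [Finset.card_univ, ← Nat.card_eq_fintype_card] at h
    change _ + (Finset.univ.filter fun x => σ x ≠ x).card = _ at h
    omega
  set S := Finset.univ.filter fun x => σ x ≠ x with hS
  have hmem : ∀ x, x ∈ S ↔ σ x ≠ x := by simp [hS]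
  obtain ⟨a, haS⟩ : S.Nonempty := by rw [← Finset.card_pos]; omega
  have ha := (hmem a).1 haS
  obtain ⟨b, hb⟩ : (S \ {a, σ a}).Nonempty := by
    rw [← Finset.card_pos]
    have := Finset.le_card_sdiff {a, σ a} S
    rw [Finset.card_pair ha.symm] at this
    omega
  simp only [Finset.mem_sdiff, Finset.mem_insert, Finset.mem_singleton, not_or] at hb
  obtain ⟨hbS, hba, hba'⟩ := hb
  have hb := (hmem b).1 hbS
  have hd : [a, σ a, b, σ b].Nodup := by
    simp only [List.nodup_cons, List.mem_cons, List.not_mem_nil, or_false, not_or,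
      List.nodup_nil, and_true, not_false_eq_true]
    refine ⟨⟨ha.symm, Ne.symm hba, fun h => ?_⟩, ⟨Ne.symm hba', fun h => ?_⟩, hb.symm⟩
    · exact hba' (by rw [h, hσ])
    · exact hba (σ.injective h).symm
  have hSeq : S = [a, σ a, b, σ b].toFinset := by
    symm
    apply Finset.eq_of_subset_of_card_le
    · intro x hx
      simp only [List.mem_toFinset, List.mem_cons, List.not_mem_nil, or_false] at hx
      rw [hmem]
      rcases hx with rfl | rfl | rfl | rfl
      · exact ha
      · rw [hσ]; exact ha.symm
      · exact hb
      · rw [hσ]; exact hb.symm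
    · rw [List.toFinset_card_of_nodup hd, hcard]
      simp
  have hmem' : ∀ x, σ x ≠ x ↔ x = a ∨ x = σ a ∨ x = b ∨ x = σ b := by
    intro x
    rw [← hmem, hSeq]
    simp
  refine ⟨a, σ a, b, σ b, hd, ?_, hmem'⟩
  obtain ⟨e₁, e₂, e₃, e₄⟩ := swap_mul_swap_apply hd
  ext x
  by_cases h : x = a ∨ x = σ a ∨ x = b ∨ x = σ b
  · rcases h with rfl | rfl | rfl | rfl
    · rw [e₁]
    · rw [e₂, hσ]
    · rw [e₃]
    · rw [e₄, hσ]
  · rw [not_not.1 (mt (hmem' x).1 h)]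
    simp only [not_or] at h
    simp [swap_apply_def, h]

/-- A wheel with two chords vanishes if it has an odd number of trivalent vertices. -/
theorem glueCls_wheel_eq_zero (hN : Odd (Nat.card N)) {σ : Perm N} (hσ : ∀ x, σ (σ x) = x)
    (hfix : Nat.card N = Nat.card {x // σ x = x} + 4) {l : List N} (hn : l.Nodup)
    (hc : ∀ x, x ∈ l) : glueCls n (wheel l.formPerm σ) = 0 := by
  obtain ⟨a, a', b, b', hd, hσeq, hmove⟩ := exists_two_chords hσ hfix
  obtain ⟨ha, ha', hb, hb'⟩ := swap_mul_swap_apply hd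
  rw [← hσeq] at ha ha' hb hb'
  have hd' := hd
  simp only [List.nodup_cons, List.mem_cons, List.not_mem_nil, or_false, not_or,
    List.nodup_nil, and_true, not_false_eq_true] at hd'
  obtain ⟨⟨h1, h2, h3⟩, ⟨h4, h5⟩, h6⟩ := hd'
  obtain ⟨u, v, rfl⟩ := List.append_of_mem (hc a)
  rw [formPerm_append_comm hn, List.cons_append]
  replace hn : (a :: (v ++ u)).Nodup := List.perm_append_comm.nodup_iff.1 hn
  replace hc : ∀ x, x ∈ a :: (v ++ u) := fun x => by
    have := hc x
    simp only [List.mem_append, List.mem_cons] at this ⊢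
    tauto
  generalize v ++ u = w at hn hc
  have hcw : ∀ x, x ≠ a → x ∈ w := fun x hx => List.mem_of_ne_of_mem hx (hc x)
  -- the two ends of the second chord may be exchanged
  have key : ∀ c c', [a, a', c, c'].Nodup → σ = swap a a' * swap c c' → σ c = c' → σ c' = c →
      (∀ x, σ x ≠ x ↔ x = a ∨ x = a' ∨ x = c ∨ x = c') → ∀ l₁ l₂ l₃,
      w = l₁ ++ c :: (l₂ ++ c' :: l₃) → glueCls n (wheel (a :: w).formPerm σ) = 0 := by
    rintro c c' hd hσeq hσc hσc' hmove l₁ l₂ l₃ rfl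
    simp only [List.nodup_cons, List.mem_cons, List.not_mem_nil, or_false, not_or,
      List.nodup_nil, and_true, not_false_eq_true] at hd
    obtain ⟨⟨h1, h2, h3⟩, ⟨h4, h5⟩, h6⟩ := hd
    have ha'w := hcw a' (Ne.symm h1)
    simp only [List.mem_append, List.mem_cons, h4, h5, false_or] at ha'w
    rcases ha'w with h | h | h
    · obtain ⟨s, t, rfl⟩ := List.append_of_mem h
      have e := glueCls_wheel_eq_fourCls (n := n) (σ := σ) (x₁ := a) (l₁ := s) (x₂ := a') (l₂ := t)
        (x₃ := c) (l₃ := l₂) (x₄ := c') (l₄ := l₃) (by simpa using hn) (by simpa using hc)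
        (fun x => by rw [hmove])
      rw [fourCls_parallel_eq_zero hN hσ h1 ha hσc] at e
      simpa using e
    · obtain ⟨s, t, rfl⟩ := List.append_of_mem h
      have e := glueCls_wheel_eq_fourCls (n := n) (σ := σ) (x₁ := a) (l₁ := l₁) (x₂ := c) (l₂ := s)
        (x₃ := a') (l₃ := t) (x₄ := c') (l₄ := l₃) (by simpa using hn) (by simpa using hc)
        (fun x => by rw [hmove]; tauto)
      rw [hσeq, fourCls_crossed_eq_zero hN (by simp [*]), ← hσeq] at e
      simpa using e
    · obtain ⟨s, t, rfl⟩ := List.append_of_mem h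
      have e := glueCls_wheel_eq_fourCls (n := n) (σ := σ) (x₁ := a) (l₁ := l₁) (x₂ := c) (l₂ := l₂)
        (x₃ := c') (l₃ := s) (x₄ := a') (l₄ := t) (by simpa using hn) (by simpa using hc)
        (fun x => by rw [hmove]; tauto)
      rw [fourCls_rotate, fourCls_parallel_eq_zero hN hσ h6 hσc ha'] at e
      simpa using e
  obtain ⟨l₁, l₂, l₃, h | h⟩ := exists_split_pair h6 (hcw b (Ne.symm h2)) (hcw b' (Ne.symm h3))
  · exact key b b' hd hσeq hb hb' hmove _ _ _ h
  · refine key b' b ?_ (by rw [hσeq, swap_comm b]) hb' hb (fun x => by rw [hmove]; tauto) _ _ _ h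
    simp [h1, h2, h3, h4, h5, Ne.symm h6]

end

/-! ### Paths and cycles -/

section

theorem isChain_concat_imp {α : Type*} {R S : α → α → Prop} {l : List α} {x : α}
    (H : ∀ a b, a ∈ l → b ∈ l ++ [x] → R a b → S a b) (h : List.IsChain R (l ++ [x])) :
    List.IsChain S (l ++ [x]) := by
  rw [List.isChain_append] at h ⊢
  refine ⟨h.1.imp_of_mem_imp fun a b ha hb => H a b ha (List.mem_append_left _ hb),
    List.isChain_singleton _,
    fun a ha b hb => H a b (List.mem_of_mem_getLast? ha) ?_ (h.2.2 a ha b hb)⟩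
  obtain rfl : x = b := by simpa using hb
  simp

variable {N : Type} {ε : N × Fin 3 → N × Fin 3}

/-- The list `l` of vertices is a path, which enters each vertex at its half-edge `1` and leaves it
at `0`. -/
def IsPath (ε : N × Fin 3 → N × Fin 3) (l : List N) : Prop :=
  List.IsChain (fun x y => ε (x, 0) = (y, 1)) l

/-- The list `l` of vertices is a cycle, which enters each vertex at its half-edge `1` and leaves it
at `0`. -/
def IsCycle [DecidableEq N] (ε : N × Fin 3 → N × Fin 3) (l : List N) : Prop :=
  ∀ x ∈ l, ε (x, 0) = (l.formPerm x, 1)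

theorem conj_apply_eq_iff {τ : Perm (N × Fin 3)} {x y : N × Fin 3} :
    conj τ ε x = y ↔ ε (τ x) = τ y := Perm.inv_eq_iff_eq

/-- A step across the boundary of a set of vertices. -/
theorem GlueConnected.exists_exit (hc : GlueConnected ε) {p : N → Prop} {i j : N} (hi : p i)
    (hj : ¬ p j) (hε : Function.Involutive ε) :
    ∃ x y t u, p x ∧ ¬ p y ∧ ε (x, t) = (y, u) := by
  by_contra hcon
  push Not at hcon
  have key : ∀ x y, Relation.EqvGen (GlueAdj ε) x y → (p x ↔ p y) := by
    intro x y h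
    induction h with
    | rel x y h =>
      obtain ⟨t, u, h⟩ := h
      refine ⟨fun hx => ?_, fun hy => ?_⟩
      · by_contra hy
        exact hcon x y t u hx hy h
      · by_contra hx
        exact hcon y x u t hy hx (by rw [← h, hε])
    | refl x => exact Iff.rfl
    | symm x y _ ih => exact ih.symm
    | trans x y z _ _ ih₁ ih₂ => exact ih₁.trans ih₂
  exact hj ((key i j (hc.2 i j)).1 hi)

variable [DecidableEq N]

section Insert

variable {i j : N}

theorem conj_insertAfter_stem (hij : i ≠ j) (h : ε (i, 2) = (j, 2)) :
    conj (insertAfter i j) ε (i, 0) = (j, 1) := by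
  rw [conj_apply_eq_iff]
  simp [insertAfter_apply hij, hij.symm, h]

theorem conj_insertAfter_end (hij : i ≠ j) {y : N} (hy : y ≠ j) (h : ε (i, 0) = (y, 1)) :
    conj (insertAfter i j) ε (j, 0) = (y, 1) := by
  rw [conj_apply_eq_iff]
  by_cases hyi : y = i
  · subst hyi
    simp [insertAfter_apply hij, hij.symm, h]
  · simp [insertAfter_apply hij, hij.symm, h, hy, hyi]

theorem conj_insertAfter_of_ne (hij : i ≠ j) {x y : N} (hxi : x ≠ i) (hxj : x ≠ j) (hy : y ≠ j)
    (h : ε (x, 0) = (y, 1)) : conj (insertAfter i j) ε (x, 0) = (y, 1) := by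
  rw [conj_apply_eq_iff]
  by_cases hyi : y = i
  · subst hyi
    simp [insertAfter_apply hij, h, hxi, hxj]
  · simp [insertAfter_apply hij, h, hxi, hxj, hy, hyi]

theorem conj_insertBefore_stem (hij : i ≠ j) (h : ε (j, 2) = (i, 2)) :
    conj (insertBefore i j) ε (j, 0) = (i, 1) := by
  rw [conj_apply_eq_iff]
  simp [insertBefore_apply hij, hij.symm, h]

theorem conj_insertBefore_start (hij : i ≠ j) {x : N} (hx : x ≠ j) (h : ε (x, 0) = (i, 1)) :
    conj (insertBefore i j) ε (x, 0) = (j, 1) := by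
  rw [conj_apply_eq_iff]
  by_cases hxi : x = i
  · subst hxi
    simp [insertBefore_apply hij, hij.symm, h]
  · simp [insertBefore_apply hij, hij.symm, h, hx, hxi]

theorem conj_insertBefore_of_ne (hij : i ≠ j) {x y : N} (hx : x ≠ j) (hyi : y ≠ i) (hyj : y ≠ j)
    (h : ε (x, 0) = (y, 1)) : conj (insertBefore i j) ε (x, 0) = (y, 1) := by
  rw [conj_apply_eq_iff]
  by_cases hxi : x = i
  · subst hxi
    simp [insertBefore_apply hij, h, hyi, hyj]
  · simp [insertBefore_apply hij, h, hx, hxi, hyi, hyj]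

end Insert

theorem IsCycle.insertAfter {i j : N} {l : List N} (hn : (i :: l).Nodup) (hj : j ∉ i :: l)
    (hl : IsCycle ε (i :: l)) (h : ε (i, 2) = (j, 2)) :
    IsCycle (conj (insertAfter i j) ε) (i :: j :: l) := by
  have hij : i ≠ j := by rintro rfl; simp at hj
  have hp : (i :: j :: l).formPerm = (i :: l).formPerm * swap i j :=
    formPerm_insert_after (l₁ := [])
      ((List.Perm.swap i j l).nodup_iff.1 (List.nodup_cons.2 ⟨hj, hn⟩))
  have hmem : ∀ x ∈ i :: l, (i :: l).formPerm x ≠ j := fun x hx e =>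
    hj (e ▸ List.formPerm_apply_mem_of_mem hx)
  intro x hx
  rw [hp, Perm.mul_apply]
  by_cases hxi : x = i
  · subst hxi
    rw [swap_apply_left, List.formPerm_apply_of_notMem hj]
    exact conj_insertAfter_stem hij h
  by_cases hxj : x = j
  · subst hxj
    rw [swap_apply_right]
    exact conj_insertAfter_end hij (hmem i (by simp)) (hl i (by simp))
  have hx' : x ∈ i :: l := by
    simp only [List.mem_cons] at hx ⊢
    tauto
  rw [swap_apply_of_ne_of_ne hxi hxj]
  exact conj_insertAfter_of_ne hij hxi hxj (hmem x hx') (hl x hx')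

theorem IsCycle.insertBefore {i j : N} {l : List N} (hj : j ∉ i :: l)
    (hl : IsCycle ε (i :: l)) (h : ε (j, 2) = (i, 2)) :
    IsCycle (conj (insertBefore i j) ε) (j :: i :: l) := by
  have hij : i ≠ j := by rintro rfl; simp at hj
  have hmem : ∀ x ∈ i :: l, (i :: l).formPerm x ≠ j := fun x hx e =>
    hj (e ▸ List.formPerm_apply_mem_of_mem hx)
  intro x hx
  rw [List.formPerm_cons_cons, Perm.mul_apply]
  by_cases hxj : x = j
  · subst hxj
    rw [List.formPerm_apply_of_notMem hj, swap_apply_left]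
    exact conj_insertBefore_stem hij h
  have hx' : x ∈ i :: l := List.mem_of_ne_of_mem hxj hx
  have hlx := hl x hx'
  by_cases hxi : (i :: l).formPerm x = i
  · rw [hxi, swap_apply_right]
    exact conj_insertBefore_start hij hxj (by rw [hlx, hxi])
  · rw [swap_apply_of_ne_of_ne (hmem x hx') hxi]
    exact conj_insertBefore_of_ne hij hxj hxi (hmem x hx') hlx

theorem IsPath.insertAfter {i j : N} {l₁ l₂ : List N} (hn : (l₁ ++ i :: l₂).Nodup)
    (hj : j ∉ l₁ ++ i :: l₂) (hl : IsPath ε (l₁ ++ i :: l₂)) (h : ε (i, 2) = (j, 2)) :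
    IsPath (conj (insertAfter i j) ε) (l₁ ++ i :: j :: l₂) := by
  have hij : i ≠ j := by rintro rfl; simp at hj
  have hne : ∀ x ∈ l₁ ++ i :: l₂, x ≠ j := by rintro x hx rfl; exact hj hx
  have hi₁ : ∀ x ∈ l₁, x ≠ i := by
    rintro x hx rfl
    exact (List.nodup_append.1 hn).2.2 x hx x (by simp) rfl
  have hi₂ : ∀ x ∈ l₂, x ≠ i := by
    rintro x hx rfl
    exact (List.nodup_cons.1 (List.nodup_append.1 hn).2.1).1 hx
  obtain ⟨h₁, h₂⟩ := List.isChain_split.1 hl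
  refine List.isChain_append_cons_cons.2 ⟨?_, conj_insertAfter_stem hij h, ?_⟩
  · refine isChain_concat_imp (fun a b ha hb hab => ?_) h₁
    exact conj_insertAfter_of_ne hij (hi₁ a ha) (hne a (by simp [ha])) (hne b (by
      simp only [List.mem_append, List.mem_cons] at hb ⊢; tauto)) hab
  · rw [List.isChain_cons] at h₂ ⊢
    refine ⟨fun y hy => conj_insertAfter_end hij ?_ (h₂.1 y hy), ?_⟩
    · exact hne y (by simp [List.mem_of_mem_head? hy])
    · refine h₂.2.imp_of_mem_imp fun a b ha hb hab => ?_
      exact conj_insertAfter_of_ne hij (hi₂ a ha) (hne a (by simp [ha])) (hne b (by simp [hb])) hab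

theorem IsPath.insertBefore {i j : N} {l₁ l₂ : List N} (hn : (l₁ ++ i :: l₂).Nodup)
    (hj : j ∉ l₁ ++ i :: l₂) (hl : IsPath ε (l₁ ++ i :: l₂)) (h : ε (j, 2) = (i, 2)) :
    IsPath (conj (insertBefore i j) ε) (l₁ ++ j :: i :: l₂) := by
  have hij : i ≠ j := by rintro rfl; simp at hj
  have hne : ∀ x ∈ l₁ ++ i :: l₂, x ≠ j := by rintro x hx rfl; exact hj hx
  have hi₁ : ∀ x ∈ l₁, x ≠ i := by
    rintro x hx rfl
    exact (List.nodup_append.1 hn).2.2 x hx x (by simp) rfl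
  have hi₂ : ∀ x ∈ l₂, x ≠ i := by
    rintro x hx rfl
    exact (List.nodup_cons.1 (List.nodup_append.1 hn).2.1).1 hx
  obtain ⟨h₁, h₂⟩ := List.isChain_split.1 hl
  refine List.isChain_append_cons_cons.2 ⟨?_, conj_insertBefore_stem hij h, ?_⟩
  · rw [List.isChain_append] at h₁ ⊢
    refine ⟨h₁.1.imp_of_mem_imp fun a b ha hb hab => ?_, List.isChain_singleton _,
      fun a ha b hb => ?_⟩
    · exact conj_insertBefore_of_ne hij (hne a (by simp [ha])) (hi₁ b hb) (hne b (by simp [hb])) hab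
    · obtain rfl : j = b := by simpa using hb
      have ha' := List.mem_of_mem_getLast? ha
      exact conj_insertBefore_start hij (hne a (by simp [ha'])) (h₁.2.2 a ha i (by simp))
  · refine h₂.imp_of_mem_tail_imp fun a b ha hb hab => ?_
    exact conj_insertBefore_of_ne hij (hne a (by simp only [List.mem_append]; tauto))
      (hi₂ b hb) (hne b (by simp only [List.tail_cons] at hb; simp [hb])) hab

theorem conj_rotateAt_of_ne {x y j : N} {t u s : Fin 3} (hx : x ≠ j) (hy : y ≠ j)
    (h : ε (x, t) = (y, u)) : conj (rotateAt j s) ε (x, t) = (y, u) := by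
  rw [conj_apply_eq_iff]
  simp [rotateAt_apply, hx, hy, h]

theorem conj_rotateAt_of_eq {x j : N} {t u s : Fin 3} (hx : x ≠ j)
    (h : ε (x, t) = (j, u)) : conj (rotateAt j s) ε (x, t) = (j, u - s) := by
  rw [conj_apply_eq_iff]
  simp [rotateAt_apply, hx, h]

/-- The free half-edges at the end of a path may be exchanged. -/
theorem IsPath.conj_swap_last {l : List N} {j : N} (hn : (l ++ [j]).Nodup)
    (h : IsPath ε (l ++ [j])) : IsPath (conj (swap (j, 2) (j, 2 + 1)) ε) (l ++ [j]) := by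
  refine isChain_concat_imp (fun a b ha hb hab => ?_) h
  have haj : a ≠ j := by
    rintro rfl
    exact (List.nodup_append.1 hn).2.2 a ha a (by simp) rfl
  rw [conj_apply_eq_iff]
  simp [swap_apply_def, haj, hab]

/-- The free half-edges at the start of a path may be exchanged. -/
theorem IsPath.conj_swap_head {l : List N} {i : N} (hn : (i :: l).Nodup)
    (h : IsPath ε (i :: l)) : IsPath (conj (swap (i, 1) (i, 1 + 1)) ε) (i :: l) := by
  refine h.imp_of_mem_tail_imp fun a b ha hb hab => ?_
  have hbi : b ≠ i := by
    rintro rfl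
    exact (List.nodup_cons.1 hn).1 hb
  rw [conj_apply_eq_iff]
  simp [swap_apply_def, hbi, hab]

theorem IsPath.isCycle {l : List N} (hn : l.Nodup) (h : IsPath ε l)
    (hc : ∀ x ∈ l.getLast?, ∀ y ∈ l.head?, ε (x, 0) = (y, 1)) : IsCycle ε l := by
  intro x hx
  obtain ⟨k, hk, rfl⟩ := List.getElem_of_mem hx
  rw [List.formPerm_apply_getElem _ hn]
  by_cases hk' : k + 1 < l.length
  · simp only [Nat.mod_eq_of_lt hk']
    exact List.isChain_iff_getElem.1 h k hk'
  · have hk₁ : k + 1 = l.length := by omega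
    simp only [hk₁, Nat.mod_self]
    apply hc
    · rw [List.getLast?_eq_getElem?, show l.length - 1 = k by omega]
      simp [hk]
    · rw [List.head?_eq_getElem?]
      simp [List.getElem?_eq_getElem (show 0 < l.length by omega)]

end

/-! ### Extending paths and cycles by IHX -/

section

theorem fin_three_cases : ∀ t : Fin 3, t = 0 ∨ t = 1 ∨ t = 2 := by decide

variable {N : Type}

theorem card_fixed_wheel {s σ : Perm N} :
    Nat.card {x // wheel s σ x = x} = Nat.card {x // σ x = x} := by
  have ht : ∀ (x : N) (t : Fin 3), wheel s σ (x, t) = (x, t) ↔ t = 2 ∧ σ x = x := by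
    intro x t
    fin_cases t <;> simp [wheel]
  refine (Nat.card_congr (Equiv.ofBijective
    (fun x : {x // σ x = x} => ⟨(x.1, 2), (ht _ _).2 ⟨rfl, x.2⟩⟩) ⟨fun x y h => ?_, ?_⟩)).symm
  · exact Subtype.ext (congrArg (fun z => z.1.1) h)
  · rintro ⟨⟨x, t⟩, h⟩
    obtain ⟨rfl, hx⟩ := (ht _ _).1 h
    exact ⟨⟨x, hx⟩, rfl⟩

theorem length_lt_card_of_notMem [Finite N] {l : List N} (hn : l.Nodup) {j : N} (hj : j ∉ l) :
    l.length < Nat.card N := by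
  have := Fintype.ofFinite N
  rw [Nat.card_eq_fintype_card]
  exact (List.nodup_cons.2 ⟨hj, hn⟩).length_le_card

variable {ε : N × Fin 3 → N × Fin 3} [DecidableEq N]

/-- A Hamiltonian cycle exhibits the diagram as a wheel. -/
theorem IsCycle.eq_wheel (hε : Function.Involutive ε) {l : List N} (hl : IsCycle ε l)
    (hc : ∀ x, x ∈ l) : ∃ σ : Perm N, (∀ x, σ (σ x) = x) ∧ ε = wheel l.formPerm σ := by
  have h0 : ∀ x, ε (x, 0) = (l.formPerm x, 1) := fun x => hl x (hc x)
  have h1 : ∀ x, ε (x, 1) = (l.formPerm⁻¹ x, 0) := fun x => by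
    have := h0 (l.formPerm⁻¹ x)
    rw [show l.formPerm (l.formPerm⁻¹ x) = x from Equiv.apply_symm_apply _ _] at this
    rw [← this, hε]
  have h2 : ∀ x, ε (x, 2) = ((ε (x, 2)).1, 2) := by
    intro x
    have h : ε (ε (x, 2)) = (x, 2) := hε _
    generalize ε (x, 2) = z at h
    obtain ⟨y, t⟩ := z
    fin_cases t
    · have e := (h0 y).symm.trans h
      simp at e
    · have e := (h1 y).symm.trans h
      simp at e
    · rfl
  have hσ : Function.Involutive fun x => (ε (x, 2)).1 := by
    intro x
    change (ε ((ε (x, 2)).1, 2)).1 = x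
    rw [← h2, hε]
  refine ⟨hσ.toPerm, hσ, ?_⟩
  ext1 ⟨x, t⟩
  fin_cases t
  · exact h0 x
  · exact h1 x
  · exact h2 x

variable [Finite N]

theorem exists_notMem_of_length_lt {l : List N} (h : l.length < Nat.card N) : ∃ j, j ∉ l := by
  have := Fintype.ofFinite N
  rw [Nat.card_eq_fintype_card] at h
  by_contra! hc
  have h₁ := Finset.card_le_card (show Finset.univ ⊆ l.toFinset from fun x _ => by simp [hc x])
  have h₂ := l.toFinset_card_le
  rw [Finset.card_univ] at h₁
  omega

/-- A cycle can be extended by IHX until it passes through all vertices; `k` is the number of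
vertices it still misses. -/
theorem IsCycle.glueCls_eq_zero (hN : Odd (Nat.card N)) (k : ℕ) {l : List N} (hn : l.Nodup)
    (hne : l ≠ []) (hk : l.length + k = Nat.card N) (hl : IsCycle ε l) : glueCls 3 ε = 0 := by
  induction k generalizing l ε with
  | zero =>
    refine glueCls_eq_zero_of fun hε hc hcard => ?_
    have hmem : ∀ x, x ∈ l := fun x => by
      by_contra hx
      have := length_lt_card_of_notMem hn hx
      omega
    obtain ⟨σ, hσ, rfl⟩ := hl.eq_wheel hε hmem
    rw [card_fixed_wheel] at hcard
    exact glueCls_wheel_eq_zero hN hσ (by omega) hn hmem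
  | succ k ih =>
    refine glueCls_eq_zero_of fun hε hc _ => ?_
    obtain ⟨j₀, hj₀⟩ := exists_notMem_of_length_lt (l := l) (by omega)
    obtain ⟨i₀, hi₀⟩ := List.exists_mem_of_ne_nil l hne
    obtain ⟨i, j, t, u, hi, hj, h⟩ := hc.exists_exit (p := fun x => x ∈ l) hi₀ hj₀ hε
    -- both other half-edges at `i` belong to the cycle
    have ht : t = 2 := by
      have h0 := hl i hi
      have h1 := hl (l.formPerm⁻¹ i) (by
        rw [← List.formPerm_mem_iff_mem]
        exact (Equiv.apply_symm_apply l.formPerm i).symm ▸ hi)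
      rw [show l.formPerm (l.formPerm⁻¹ i) = i from Equiv.apply_symm_apply _ _] at h1
      have hmem : l.formPerm⁻¹ i ∈ l := by
        rw [← List.formPerm_mem_iff_mem]
        exact (Equiv.apply_symm_apply l.formPerm i).symm ▸ hi
      obtain rfl | rfl | rfl := fin_three_cases t
      · rw [h0] at h
        refine absurd ?_ hj
        rw [← show l.formPerm i = j from congrArg Prod.fst h]
        exact List.formPerm_apply_mem_of_mem hi
      · have h1' := congrArg ε h1
        rw [hε] at h1'
        have e : l.formPerm⁻¹ i = j := congrArg Prod.fst (h1'.trans h)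
        exact absurd (e ▸ hmem) hj
      · rfl
    subst ht
    obtain ⟨l₁, l₂, rfl⟩ := List.append_of_mem hi
    have hp : (i :: (l₂ ++ l₁)).formPerm = (l₁ ++ i :: l₂).formPerm :=
      (formPerm_append_comm hn).symm
    have hperm : (l₁ ++ i :: l₂).Perm (i :: (l₂ ++ l₁)) := List.perm_append_comm
    have hn' := hperm.nodup_iff.1 hn
    have hj' : j ∉ i :: (l₂ ++ l₁) := fun h => hj (hperm.mem_iff.2 h)
    have hij : i ≠ j := by rintro rfl; simp at hj'
    rw [← glueCls_conj_rotateAt j (u - 2) ε]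
    set ε' := conj (rotateAt j (u - 2)) ε with hε'
    have hl' : IsCycle ε' (i :: (l₂ ++ l₁)) := by
      intro x hx
      rw [hp]
      have hx' := hperm.mem_iff.2 hx
      refine conj_rotateAt_of_ne ?_ ?_ (hl x hx')
      · rintro rfl; exact hj hx'
      · intro e
        exact hj (e ▸ List.formPerm_apply_mem_of_mem hx')
    have hinv : Function.Involutive ε' := involutive_of_conj _ (apply_conj _ _) hε
    have h2 : ε' (i, 2) = (j, 2) := by
      rw [hε', conj_rotateAt_of_eq hij h, sub_sub_cancel]
    have h2' : ε' (j, 2) = (i, 2) := by rw [← h2, hinv]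
    have hlen := hperm.length_eq
    have hp₁ := List.Perm.swap i j (l₂ ++ l₁)
    rw [glueCls_insert hij h2,
      ih (hp₁.nodup_iff.1 (List.nodup_cons.2 ⟨hj', hn'⟩)) (List.cons_ne_nil _ _) (by
        simp only [List.length_cons] at hlen ⊢; omega) (hl'.insertAfter hn' hj' h2),
      ih (List.nodup_cons.2 ⟨hj', hn'⟩) (List.cons_ne_nil _ _) (by
        simp only [List.length_cons] at hlen ⊢; omega) (hl'.insertBefore hj' h2'), sub_zero]

/-- A path whose ends are joined by an edge can be made into a cycle by reversing the cyclic orders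
at its ends, if necessary. -/
theorem IsPath.glueCls_eq_zero_of_closed (hN : Odd (Nat.card N)) {l : List N} (hn : l.Nodup)
    (hne : l ≠ []) (hl : IsPath ε l) {s t : Fin 3} (hs : s ≠ 1) (ht : t ≠ 0)
    (hc : ∀ x ∈ l.getLast?, ∀ y ∈ l.head?, ε (x, s) = (y, t) ∧ (x, s) ≠ (y, t)) :
    glueCls 3 ε = 0 := by
  have hlen : l.length ≤ Nat.card N := by
    have := Fintype.ofFinite N
    rw [Nat.card_eq_fintype_card]
    exact hn.length_le_card
  have closed₁ : ∀ {ε : N × Fin 3 → N × Fin 3}, IsPath ε l →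
      (∀ x ∈ l.getLast?, ∀ y ∈ l.head?, ε (x, 0) = (y, 1)) → glueCls 3 ε = 0 := fun hl hc =>
    (hl.isCycle hn hc).glueCls_eq_zero hN (Nat.card N - l.length) hn hne (by omega)
  have closed₂ : ∀ {ε : N × Fin 3 → N × Fin 3}, IsPath ε l →
      (∀ x ∈ l.getLast?, ∀ y ∈ l.head?, ε (x, 0) = (y, t)) → glueCls 3 ε = 0 := by
    intro ε hl hc
    by_cases ht1 : t = 1
    · subst ht1; exact closed₁ hl hc
    obtain rfl : t = 2 := ((fin_three_cases t).resolve_left ht).resolve_left ht1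
    obtain ⟨i, l', rfl⟩ := List.exists_cons_of_ne_nil hne
    rw [← neg_eq_zero, ← glueCls_conj_swap i 1]
    refine closed₁ (hl.conj_swap_head hn) fun x hx y hy => ?_
    obtain rfl : i = y := by simpa using hy
    rw [conj_apply_eq_iff]
    have := hc x hx i hy
    simp [swap_apply_def, this]
  by_cases hs0 : s = 0
  · subst hs0; exact closed₂ hl fun x hx y hy => (hc x hx y hy).1
  obtain rfl : s = 2 := ((fin_three_cases s).resolve_left hs0).resolve_left hs
  obtain ⟨l', j, rfl⟩ : ∃ l' j, l = l' ++ [j] := ⟨_, _, (List.dropLast_append_getLast hne).symm⟩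
  rw [← neg_eq_zero, ← glueCls_conj_swap j 2]
  refine closed₂ (hl.conj_swap_last hn) fun x hx y hy => ?_
  obtain rfl : j = x := by simpa using hx
  obtain ⟨h₁, h₂⟩ := hc j hx y hy
  rw [conj_apply_eq_iff]
  have e : (swap (j, 2) (j, 2 + 1) : Perm (N × Fin 3)) (j, 0) = (j, 2) := swap_apply_right _ _
  rw [e, h₁, swap_apply_of_ne_of_ne h₂.symm fun e => ht (congrArg Prod.snd e)]

/-- A path can be extended by IHX until it passes through all vertices, where `k` is the number of
vertices it still misses; then an edge outside of it closes a part of it to a cycle. -/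
theorem IsPath.glueCls_eq_zero (hN : Odd (Nat.card N)) (k : ℕ) {l : List N} (hn : l.Nodup)
    (hne : l ≠ []) (hk : l.length + k = Nat.card N) (hl : IsPath ε l) : glueCls 3 ε = 0 := by
  induction k generalizing l ε with
  | zero =>
    refine glueCls_eq_zero_of fun hε hc hcard => ?_
    have hmem : ∀ x, x ∈ l := fun x => by
      by_contra hx
      have := length_lt_card_of_notMem hn hx
      omega
    -- there are fewer legs than trivalent vertices
    obtain ⟨i, hi⟩ : ∃ i, ε (i, 2) ≠ (i, 2) := by
      by_contra! hall
      have := Nat.card_le_card_of_injective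
        (fun i : N => (⟨(i, 2), hall i⟩ : {x // ε x = x}))
        fun x y h => congrArg (fun z => z.1.1) h
      omega
    obtain ⟨j, t, h⟩ : ∃ j t, ε (i, 2) = (j, t) := ⟨_, _, rfl⟩
    have h' : ε (j, t) = (i, 2) := by rw [← h, hε]
    have hsub : ∀ {l₁ l₂ l₃ : List N}, l = l₁ ++ (l₂ ++ l₃) → l₂.Nodup ∧ IsPath ε l₂ := by
      rintro l₁ l₂ l₃ rfl
      exact ⟨(List.nodup_append.1 (List.nodup_append.1 hn).2.1).1,
        (List.IsChain.right_of_append hl).left_of_append⟩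
    obtain rfl | rfl | rfl := fin_three_cases t
    · -- the path leaves every vertex but the last one
      obtain ⟨l₁, l₂, e⟩ := List.append_of_mem (hmem j)
      obtain rfl : l₂ = [] := by
        by_contra hl₂
        obtain ⟨y, l₂, rfl⟩ := List.exists_cons_of_ne_nil hl₂
        rw [e] at hl
        have := (List.isChain_append_cons_cons.1 hl).2.1
        have := this.symm.trans h'
        simp at this
      obtain ⟨l₃, l₄, e'⟩ := List.append_of_mem (hmem i)
      obtain ⟨n', p'⟩ := hsub (l₁ := l₃) (l₂ := i :: l₄) (l₃ := []) (by simp [e'])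
      refine p'.glueCls_eq_zero_of_closed hN n' (by simp) (s := 0) (t := 2) (by decide)
        (by decide) fun x hx y hy => ?_
      obtain rfl : i = y := by simpa using hy
      have hx' : x ∈ l.getLast? := by
        rw [e', List.getLast?_append_of_ne_nil _ (by simp)]
        exact hx
      rw [e] at hx'
      obtain rfl : j = x := by simpa using hx'
      exact ⟨h', by simp⟩
    · -- the path enters every vertex but the first one
      obtain ⟨l₁, l₂, e⟩ := List.append_of_mem (hmem j)
      obtain rfl : l₁ = [] := by
        by_contra hl₁
        obtain ⟨l₀, y, rfl⟩ : ∃ l' y, l₁ = l' ++ [y] :=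
          ⟨_, _, (List.dropLast_append_getLast hl₁).symm⟩
        rw [e, List.append_assoc] at hl
        have := (List.isChain_append_cons_cons.1 hl).2.1
        have this := congrArg ε this
        rw [hε, h'] at this
        simp at this
      obtain ⟨l₃, l₄, e'⟩ := List.append_of_mem (hmem i)
      obtain ⟨n', p'⟩ := hsub (l₁ := []) (l₂ := l₃ ++ [i]) (l₃ := l₄) (by simp [e'])
      refine p'.glueCls_eq_zero_of_closed hN n' (by simp) (s := 2) (t := 1) (by decide)
        (by decide) fun x hx y hy => ?_
      obtain rfl : i = x := by simpa using hx
      have hy' : y ∈ l.head? := by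
        rw [e', List.append_cons, List.head?_append_of_ne_nil _ (by simp)]
        exact hy
      rw [e] at hy'
      obtain rfl : j = y := by simpa using hy'
      exact ⟨h, by simp⟩
    · have hij : i ≠ j := by rintro rfl; exact hi h
      obtain ⟨l₁, l₂, l₃, e | e⟩ := exists_split_pair hij (hmem i) (hmem j)
      · obtain ⟨n', p'⟩ := hsub (l₁ := l₁) (l₂ := i :: l₂ ++ [j]) (l₃ := l₃) (by simp [e])
        refine p'.glueCls_eq_zero_of_closed hN n' (by simp) (s := 2) (t := 2) (by decide)
          (by decide) fun x hx y hy => ?_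
        obtain rfl : i = y := by simpa using hy
        rw [List.getLast?_concat] at hx
        obtain rfl : j = x := by simpa using hx
        exact ⟨h', by simp [hij.symm]⟩
      · obtain ⟨n', p'⟩ := hsub (l₁ := l₁) (l₂ := j :: l₂ ++ [i]) (l₃ := l₃) (by simp [e])
        refine p'.glueCls_eq_zero_of_closed hN n' (by simp) (s := 2) (t := 2) (by decide)
          (by decide) fun x hx y hy => ?_
        obtain rfl : j = y := by simpa using hy
        rw [List.getLast?_concat] at hx
        obtain rfl : i = x := by simpa using hx
        exact ⟨h, by simp [hij]⟩
  | succ k ih =>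
    -- a vertex joined to the free half-edge of a vertex of the path can be inserted next to it
    have step : ∀ {ε : N × Fin 3 → N × Fin 3} {i j : N} {u : Fin 3}, Function.Involutive ε →
        IsPath ε l → i ∈ l → j ∉ l → ε (i, 2) = (j, u) → glueCls 3 ε = 0 := by
      intro ε i j u hε hl hi hj h
      have hij : i ≠ j := by rintro rfl; exact hj hi
      rw [← glueCls_conj_rotateAt j (u - 2) ε]
      have hinv : Function.Involutive (conj (rotateAt j (u - 2)) ε) :=
        involutive_of_conj _ (apply_conj _ _) hε
      have h2 : conj (rotateAt j (u - 2)) ε (i, 2) = (j, 2) := by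
        rw [conj_rotateAt_of_eq hij h, sub_sub_cancel]
      have h2' : conj (rotateAt j (u - 2)) ε (j, 2) = (i, 2) := by rw [← h2, hinv]
      have hl' : IsPath (conj (rotateAt j (u - 2)) ε) l :=
        hl.imp_of_mem_imp fun a b ha hb hab =>
          conj_rotateAt_of_ne (by rintro rfl; exact hj ha) (by rintro rfl; exact hj hb) hab
      obtain ⟨l₁, l₂, rfl⟩ := List.append_of_mem hi
      have hp₁ : (j :: (l₁ ++ i :: l₂)).Perm (l₁ ++ j :: i :: l₂) := List.perm_middle.symm
      have hp₂ : (l₁ ++ j :: i :: l₂).Perm (l₁ ++ i :: j :: l₂) :=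
        (List.Perm.swap i j l₂).append_left l₁
      have hn₁ := hp₁.nodup_iff.1 (List.nodup_cons.2 ⟨hj, hn⟩)
      have hlen : (l₁ ++ j :: i :: l₂).length + k = Nat.card N := by
        rw [← hp₁.length_eq, ← hk, List.length_cons]
        omega
      rw [glueCls_insert hij h2,
        ih (hp₂.nodup_iff.1 hn₁) (by simp) (by rw [← hp₂.length_eq, hlen])
          (hl'.insertAfter hn hj h2),
        ih hn₁ (by simp) hlen (hl'.insertBefore hn hj h2'), sub_zero]
    refine glueCls_eq_zero_of fun hε hc _ => ?_
    obtain ⟨j₀, hj₀⟩ := exists_notMem_of_length_lt (l := l) (by omega)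
    obtain ⟨i₀, hi₀⟩ := List.exists_mem_of_ne_nil l hne
    obtain ⟨i, j, t, u, hi, hj, h⟩ := hc.exists_exit (p := fun x => x ∈ l) hi₀ hj₀ hε
    have hij : i ≠ j := by rintro rfl; exact hj hi
    obtain rfl | rfl | rfl := fin_three_cases t
    · obtain ⟨l₁, l₂, rfl⟩ := List.append_of_mem hi
      obtain rfl : l₂ = [] := by
        by_contra hl₂
        obtain ⟨y, l₂, rfl⟩ := List.exists_cons_of_ne_nil hl₂
        have := h.symm.trans (List.isChain_append_cons_cons.1 hl).2.1
        obtain rfl : j = y := congrArg Prod.fst this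
        simp at hj
      rw [← neg_eq_zero, ← glueCls_conj_swap i 2]
      refine step (u := u) (involutive_of_conj _ (apply_conj _ _) hε) (hl.conj_swap_last hn) hi hj ?_
      rw [conj_apply_eq_iff, swap_apply_left]
      simp [swap_apply_def, hij.symm, h]
    · obtain ⟨l₁, l₂, rfl⟩ := List.append_of_mem hi
      obtain rfl : l₁ = [] := by
        by_contra hl₁
        obtain ⟨l₀, y, rfl⟩ : ∃ l' y, l₁ = l' ++ [y] :=
          ⟨_, _, (List.dropLast_append_getLast hl₁).symm⟩
        have hl' := hl
        rw [List.append_assoc] at hl'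
        have e := congrArg ε (List.isChain_append_cons_cons.1 hl').2.1
        rw [hε, h] at e
        obtain rfl : y = j := congrArg Prod.fst e
        simp at hj
      rw [← neg_eq_zero, ← glueCls_conj_swap i 1]
      refine step (u := u) (involutive_of_conj _ (apply_conj _ _) hε) (hl.conj_swap_head hn) hi hj ?_
      have e : (swap (i, 1) (i, 1 + 1) : Perm (N × Fin 3)) (i, 2) = (i, 1) := swap_apply_right _ _
      rw [conj_apply_eq_iff, e]
      simp [swap_apply_def, hij.symm, h]
    · exact step hε hl hi hj h

/-- A diagram with an odd number of trivalent vertices vanishes. -/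
theorem glueCls_eq_zero (hN : Odd (Nat.card N)) (ε : N × Fin 3 → N × Fin 3) :
    glueCls 3 ε = 0 := by
  obtain ⟨i⟩ : Nonempty N := (Nat.card_pos_iff.1 hN.pos).1
  have := hN.pos
  exact IsPath.glueCls_eq_zero hN (Nat.card N - 1) (List.nodup_singleton i) (by simp)
    (by simp only [List.length_singleton]; omega) (List.isChain_singleton i)

end

/-! ### Every three-loop diagram is glued -/

section

/-- The trivalent half-edges can be labelled by a trivalent vertex and a position at it. -/
theorem exists_labelling (D : JacobiDiagram) :
    ∃ (N : Type) (_ : Finite N) (f : N × Fin 3 → D.H), Function.Injective f ∧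
      (∀ x, f (turn N x) = D.vert (f x)) ∧ ∀ h, D.vert h ≠ h ↔ ∃ x, f x = h := by
  have := D.finite_H
  let r : D.H → D.H := fun h => (Quotient.mk (Perm.SameCycle.setoid D.vert) h).out
  have hr : ∀ h, D.vert.SameCycle (r h) h := fun h =>
    Quotient.mk_out (s := Perm.SameCycle.setoid D.vert) h
  have hr' : ∀ h k, D.vert.SameCycle h k → r h = r k := fun h k hk =>
    congrArg Quotient.out (Quotient.sound (s := Perm.SameCycle.setoid D.vert) hk)
  have hfix : ∀ h k, D.vert.SameCycle h k → D.vert k ≠ k → D.vert h ≠ h := by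
    intro h k hk hne he
    rw [sameCycle_vert_iff, he, he] at hk
    obtain rfl : k = h := by tauto
    exact hne he
  have h3 := D.vert_vert_vert
  -- representatives of the trivalent vertices
  let f : {h : D.H // D.vert h ≠ h ∧ r h = h} × Fin 3 → D.H := fun x =>
    ![x.1.1, D.vert x.1.1, D.vert (D.vert x.1.1)] x.2
  have hf : ∀ x, D.vert.SameCycle x.1.1 (f x) := by
    rintro ⟨x, t⟩
    rw [sameCycle_vert_iff]
    obtain rfl | rfl | rfl := fin_three_cases t <;> simp [f]
  have hturn : ∀ x, f (turn _ x) = D.vert (f x) := by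
    rintro ⟨x, t⟩
    obtain rfl | rfl | rfl := fin_three_cases t <;> simp [f, h3]
  refine ⟨_, inferInstance, f, ?_, hturn, fun h => ⟨fun hh => ?_, ?_⟩⟩
  · rintro ⟨x, t⟩ ⟨y, u⟩ h
    have hxy : x = y := by
      have h1 := hf (x, t)
      rw [h] at h1
      have := hr' _ _ (h1.trans (hf (y, u)).symm)
      rw [x.2.2, y.2.2] at this
      exact Subtype.ext this
    subst hxy
    have hx := x.2.1
    have hx' : D.vert (D.vert x.1) ≠ x.1 := fun e => hx (by
      have := congrArg D.vert e; rw [h3] at this; exact this.symm)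
    refine congrArg _ ?_
    obtain rfl | rfl | rfl := fin_three_cases t <;>
      obtain rfl | rfl | rfl := fin_three_cases u <;>
      simp [f, hx, hx', hx.symm, hx'.symm] at h ⊢
  · have hN : D.vert (r h) ≠ r h ∧ r (r h) = r h := ⟨hfix _ _ (hr h) hh, hr' _ _ (hr h)⟩
    rcases (sameCycle_vert_iff D _ _).1 (hr h) with e | e | e
    · exact ⟨(⟨r h, hN⟩, 0), e.symm⟩
    · exact ⟨(⟨r h, hN⟩, 1), e.symm⟩
    · exact ⟨(⟨r h, hN⟩, 2), e.symm⟩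
  · rintro ⟨x, rfl⟩
    exact hfix _ _ (hf x).symm x.1.2.1

/-- A diagram without an edge joining two univalent vertices comes from a gluing. -/
theorem exists_iso_ofGluing (D : JacobiDiagram)
    (hD : ∀ h, D.vert h = h → D.vert (D.edge h) ≠ D.edge h) :
    ∃ (N : Type) (_ : Finite N) (ε : N × Fin 3 → N × Fin 3) (hε : Function.Involutive ε),
      Nonempty (Iso D (ofGluing ε hε)) := by
  classical
  obtain ⟨N, hN, f, hf, hturn, hrange⟩ := D.exists_labelling
  let ε : N × Fin 3 → N × Fin 3 := fun x => if h : ∃ y, f y = D.edge (f x) then h.choose else x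
  have hε₁ : ∀ x y, f y = D.edge (f x) → ε x = y := by
    intro x y h
    have hex : ∃ y, f y = D.edge (f x) := ⟨y, h⟩
    exact (dif_pos hex).trans (hf (hex.choose_spec.trans h.symm))
  have hε₂ : ∀ x, (¬ ∃ y, f y = D.edge (f x)) → ε x = x := fun x h => dif_neg h
  have hε₃ : ∀ x, ε x = x → ¬ ∃ y, f y = D.edge (f x) := by
    rintro x h ⟨y, hy⟩
    have := hε₁ x y hy
    rw [h] at this
    subst this
    exact D.edge_ne _ hy.symm
  have hε : Function.Involutive ε := by
    intro x
    by_cases h : ∃ y, f y = D.edge (f x)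
    · obtain ⟨y, hy⟩ := h
      rw [hε₁ x y hy]
      exact hε₁ y x (by rw [hy, D.edge_edge])
    · rw [hε₂ x h, hε₂ x h]
  let g : (ofGluing ε hε).H → D.H := Sum.elim f fun x => D.edge (f x.1)
  have hg : Function.Bijective g := by
    constructor
    · rintro (x | x) (y | y) h
      · exact congrArg Sum.inl (hf h)
      · exact (hε₃ y.1 y.2 ⟨x, h⟩).elim
      · exact (hε₃ x.1 x.2 ⟨y, h.symm⟩).elim
      · exact congrArg Sum.inr (Subtype.ext (hf (D.edge.injective h)))
    · intro h
      by_cases hh : D.vert h = h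
      · obtain ⟨x, hx⟩ := (hrange _).1 (hD h hh)
        have hx' : D.edge (f x) = h := by rw [hx, D.edge_edge]
        refine ⟨Sum.inr ⟨x, hε₂ x ?_⟩, hx'⟩
        rw [hx', ← hrange]
        exact not_not.2 hh
      · obtain ⟨x, hx⟩ := (hrange _).1 hh
        exact ⟨Sum.inl x, hx⟩
  refine ⟨N, hN, ε, hε, ⟨Iso.symm ⟨Equiv.ofBijective g hg, ?_, ?_⟩⟩⟩
  · rintro (x | x)
    · exact hturn x
    · refine (not_not.1 (mt (hrange _).1 (hε₃ x.1 x.2))).symm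
  · rintro (x | x)
    · by_cases hx : ε x = x
      · rw [ofGluing_edge_inl_of_eq hε hx]
        rfl
      · rw [ofGluing_edge_inl_of_ne hε hx]
        obtain ⟨y, hy⟩ := not_not.1 (mt (hε₂ x) hx)
        change f (ε x) = D.edge (f x)
        rw [hε₁ x y hy, hy]
    · rw [ofGluing_edge_inr]
      exact (D.edge_edge _).symm

/-- In a diagram with at least two loops, no edge joins two univalent vertices: such an edge would
be the whole diagram. -/
theorem IsNLoop.vert_edge_ne {n : ℕ} (hn : 2 ≤ n) {D : JacobiDiagram} (hD : D.IsNLoop n) {h : D.H}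
    (hh : D.vert h = h) : D.vert (D.edge h) ≠ D.edge h := by
  intro he
  have key : ∀ x y, Relation.EqvGen (fun u v => v = D.vert u ∨ v = D.edge u) x y →
      ((x = h ∨ x = D.edge h) ↔ (y = h ∨ y = D.edge h)) := by
    intro x y hxy
    induction hxy with
    | rel x y h' =>
      have hedge := D.edge_edge
      rcases h' with rfl | rfl
      · constructor
        · rintro (rfl | rfl)
          · exact .inl hh
          · exact .inr he
        · rintro (h' | h')
          · exact .inl (D.vert.injective (h'.trans hh.symm))
          · exact .inr (D.vert.injective (h'.trans he.symm))
      · rw [D.edge.apply_eq_iff_eq, or_comm, ← D.edge.apply_eq_iff_eq (x := x), hedge]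
    | refl x => exact Iff.rfl
    | symm x y _ ih => exact ih.symm
    | trans x y z _ _ ih₁ ih₂ => exact ih₁.trans ih₂
  have hall : ∀ x, x = h ∨ x = D.edge h := fun x => (key h x (hD.1.2 h x)).1 (.inl rfl)
  have hcard : Nat.card D.H ≤ 2 := by
    rw [← Nat.card_univ, show (Set.univ : Set D.H) = {h, D.edge h} from
      (Set.eq_univ_of_forall hall).symm, Nat.card_coe_set_eq]
    exact (Set.ncard_pair (D.edge_ne h).symm).le
  have h₁ := D.two_mul_card_edge
  have h₂ := hD.2
  rw [eulerNumber] at h₂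
  have := D.finite_H
  have : Finite D.Vertex := Quotient.finite _
  have : Nonempty D.Vertex := ⟨Quotient.mk _ h⟩
  have h₃ := Nat.card_pos (α := D.Vertex)
  omega

/-- The number of vertices is `2 f + 4`, where `f` is the number of legs. -/
theorem IsNLoop.card_vertex_eq {D : JacobiDiagram} (hD : D.IsNLoop 3) :
    Nat.card D.Vertex = 2 * D.numLegs + 4 := by
  obtain ⟨N, _, ε, hε, ⟨φ⟩⟩ := D.exists_iso_ofGluing fun h hh => hD.vert_edge_ne (by norm_num) hh
  have := ((isNLoop_ofGluing_iff hε).1 (φ.isNLoop hD)).2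
  rw [φ.card_vertex, φ.numLegs_eq, card_vertex_ofGluing, numLegs_ofGluing]
  omega

theorem toSpace_eq_zero (D : NLoopDiagram 3) (hD : Odd D.1.numLegs) : D.toSpace = 0 := by
  classical
  obtain ⟨N, _, ε, hε, ⟨φ⟩⟩ :=
    D.1.exists_iso_ofGluing fun h hh => D.2.vert_edge_ne (by norm_num) hh
  have h := ((isNLoop_ofGluing_iff hε).1 (φ.isNLoop D.2)).2
  rw [← cls_eq_toSpace, φ.cls_eq, ← glueCls_eq hε]
  apply glueCls_eq_zero
  rw [φ.numLegs_eq, numLegs_ofGluing] at hD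
  rw [show Nat.card N = Nat.card {x // ε x = x} + 4 by omega]
  exact hD.add_even (by decide)

end

end JacobiDiagram

theorem theorem3p1 :
    NLoopSpace.oddPart 3 = ⊥ ∧
      ∀ D : NLoopDiagram 3, Odd D.1.numLegs → D.toSpace = 0 := by
  refine ⟨?_, JacobiDiagram.toSpace_eq_zero⟩
  rw [NLoopSpace.oddPart, Submodule.span_eq_bot]
  rintro _ ⟨D, ⟨d, hd, h⟩, rfl⟩
  refine JacobiDiagram.toSpace_eq_zero D ?_
  -- the degree is the number of legs plus `2`
  rw [JacobiDiagram.degree, D.2.card_vertex_eq] at h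
  push_cast at h
  have h' : ((D.1.numLegs + 2 : ℕ) : ℚ) = d := by push_cast; linarith
  have h'' : D.1.numLegs + 2 = d := by exact_mod_cast h'
  rcases hd with ⟨k, rfl⟩
  exact ⟨k - 1, by omega⟩
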